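/- Let $n\ge 3$, let $p\in(n,\infty]$ and let $q=p/(p-1)\in[1,\tfrac{n}{n-1})$ be its conjugate exponent ($q=1$ if $p=\infty$). Let $\sigma$ be the rotation-invariant surface measure on the unit sphere $\mathbb S^{n-1}\subset\mathbb R^n$, normalized by $\sigma(\mathbb S^{n-1})=1$, and for $x$ in the open unit ball $\mathbb B^n$ and $\ell\in\mathbb S^{n-1}$ put $$\mathcal K_p(x;\ell)=\int_{\mathbb S^{n-1}}|\eta-x|^{2(n-1)(q-1)}\,|\langle\eta,\ell\rangle|^{q}\,d\sigma(\eta).$$ Let $x\in\mathbb B^n$ and let $t\in\mathbb S^{n-1}$ be any tangential direction at $x$, that is, $\langle t,x\rangle=0$ (for instance $t=\ell_{\pi/2}=e_2$ if $x=|x|e_1$). Then $$\max_{\ell\in\mathbb S^{n-1}}\mathcal K_p(x;\ell)=\mathcal K_p(x;t)=\frac{n-2}{2\sqrt\pi}\,\frac{\Gamma\left(\frac{n-2}{2}\right)\Gamma\left(\frac{q+1}{2}\right)}{\Gamma\left(\frac{q+n}{2}\right)}\;{}_2F_1\left((n-1)(1-q),\ \frac n2+q\left(\frac12-n\right);\ \frac{q+n}{2};\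 |x|^2\right),$$ where ${}_2F_1(a,b;c;z)=\sum_{k\ge0}\frac{(a)_k(b)_k}{(c)_k}\frac{z^k}{k!}$ is the Gauss hypergeometric function. -/

import Mathlib

open scoped ENNReal

/-- The rotation-invariant surface measure `σ` on the unit sphere of `ℝⁿ`, normalized to have
total mass one. -/
noncomputable def normalizedSphereMeasure (n : ℕ) :
    MeasureTheory.Measure (Metric.sphere (0 : EuclideanSpace ℝ (Fin n)) 1) :=
  ((MeasureTheory.volume : MeasureTheory.Measure (EuclideanSpace ℝ (Fin n))).toSphere Set.univ)⁻¹ •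
    (MeasureTheory.volume : MeasureTheory.Measure (EuclideanSpace ℝ (Fin n))).toSphere

/-- The quantity `𝒦_p(x; ℓ) = ∫ |η - x|^{2(n-1)(q-1)} |⟨η, ℓ⟩|^q dσ(η)` over the unit sphere of
`ℝⁿ`. It depends on `p` only through the conjugate exponent `q`, which is the argument here. -/
noncomputable def khavinsonK {n : ℕ} (q : ℝ) (x ℓ : EuclideanSpace ℝ (Fin n)) : ℝ :=
  ∫ η : Metric.sphere (0 : EuclideanSpace ℝ (Fin n)) 1,
    ‖(η : EuclideanSpace ℝ (Fin n)) - x‖ ^ (2 * ((n : ℝ) - 1) * (q - 1)) *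
      |inner ℝ (η : EuclideanSpace ℝ (Fin n)) ℓ| ^ q ∂(normalizedSphereMeasure n)

open MeasureTheory Set Metric

/-! Write `x = r • e` and `ℓ = a • e + b • t` with `e ⊥ t` unit vectors and `a² + b² = 1`. For a
uniform point `η` of the sphere, `(⟨η, e⟩, ⟨η, t⟩)` has the law of `(τ, v) / √(1 + τ²)` with `τ`,
`v` independent: `τ` has density proportional to `(1 + τ²)^(-n/2)`, and `v` is symmetric in `[-1,
1]`. By homogeneity `𝒦` becomes `∫ f(u) w(τ) R(τ)`, where `u = τ / √(1 + τ²)`, `f(u) = (1 + r² -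
2ru)^s`, `s = (n-1)(q-1)`, `w = (1 + τ²)^(-q/2)` and `R(τ)` is the mean of `|aτ + bv|^q` over `v`.

Maximality: `p > n` gives `0 ≤ s ≤ 1`, so `f` is concave and `f(u) + f(-u)` decreases in `|τ|`,
while `R` is even and convex, hence increases in `|τ|`. For `ℓ = t` the function `R` is a constant
`m`, and rotation invariance gives `∫ w (R - m) = 0`. Chebyshev's inequality then yields `∫ f w (R -
m) ≤ 0` (`sliceMean_le`).

Value: for `ℓ = t` the integral factors as `m ∫ f w`. Expanding `f` binomially leaves even moments,
which are Beta integrals; the resulting series in `4r² / (1 + r²)²` is turned into a hypergeometric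
function of `r²` by a quadratic transformation (`one_add_rpow_mul_evenBinomialSum`). -/

/-! ### Sphere integrals as ball integrals, sliced in gnomonic coordinates -/

theorem lintegral_comp_smul_addHaar {E : Type*} [NormedAddCommGroup E] [NormedSpace ℝ E]
    [MeasurableSpace E] [BorelSpace E] [FiniteDimensional ℝ E] (μ : Measure E)
    [μ.IsAddHaarMeasure] {c : ℝ} (hc : c ≠ 0) {f : E → ℝ≥0∞} (hf : Measurable f) :
    ∫⁻ z, f (c • z) ∂μ = ENNReal.ofReal |(c ^ Module.finrank ℝ E)⁻¹| * ∫⁻ z, f z ∂μ := by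
  rw [← lintegral_map (f := f) (g := fun z => c • z) hf (measurable_const_smul c),
    Measure.map_addHaar_smul μ hc, lintegral_smul_measure, smul_eq_mul]

/-- Polar coordinates. Passing to functions on the ball that are constant along rays makes Fubini
and scaling of Lebesgue measure available; the factor is the radial mass of `(0, 1)`. -/
theorem lintegral_ball_normalize {E : Type*} [NormedAddCommGroup E] [NormedSpace ℝ E]
    [MeasurableSpace E] [BorelSpace E] [FiniteDimensional ℝ E] [Nontrivial E] (μ : Measure E)
    [μ.IsAddHaarMeasure] {h : E → ℝ≥0∞} (hh : Measurable h) :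
    ∫⁻ y in ball 0 1, h (‖y‖⁻¹ • y) ∂μ =
      Measure.volumeIoiPow (Module.finrank ℝ E - 1) (Iio ⟨1, mem_Ioi.2 one_pos⟩) *
        ∫⁻ η : sphere (0 : E) 1, h η ∂μ.toSphere := by
  set g : sphere (0 : E) 1 × Ioi (0 : ℝ) → ℝ≥0∞ :=
    fun p => h p.1 * (Iio (⟨1, mem_Ioi.2 one_pos⟩ : Ioi (0 : ℝ))).indicator 1 p.2 with hg
  have hgm : Measurable g :=
    (hh.comp (measurable_subtype_coe.comp measurable_fst)).mul
      ((measurable_one.indicator measurableSet_Iio).comp measurable_snd)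
  have key := (μ.measurePreserving_homeomorphUnitSphereProd).lintegral_comp hgm
  have hr : ∫⁻ p, g p ∂(μ.toSphere.prod (Measure.volumeIoiPow (Module.finrank ℝ E - 1))) =
      (∫⁻ η : sphere (0 : E) 1, h η ∂μ.toSphere) *
        Measure.volumeIoiPow (Module.finrank ℝ E - 1) (Iio ⟨1, mem_Ioi.2 one_pos⟩) := by
    rw [hg, lintegral_prod_mul (f := fun η : sphere (0 : E) 1 => h η)
      (g := (Iio (⟨1, mem_Ioi.2 one_pos⟩ : Ioi (0 : ℝ))).indicator 1)
      (hh.comp measurable_subtype_coe).aemeasurable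
      (measurable_one.indicator measurableSet_Iio).aemeasurable,
      lintegral_indicator_one measurableSet_Iio]
  rw [hr] at key
  rw [mul_comm, ← key]
  have hl : ∀ y : ({0}ᶜ : Set E), g (homeomorphUnitSphereProd E y) =
      (ball (0 : E) 1).indicator (fun y => h (‖y‖⁻¹ • y)) y := by
    intro y
    simp only [hg, homeomorphUnitSphereProd_apply_fst_coe]
    have hiff : (homeomorphUnitSphereProd E y).2 ∈ Iio (⟨1, mem_Ioi.2 one_pos⟩ : Ioi (0 : ℝ)) ↔
        (y : E) ∈ ball (0 : E) 1 := by
      rw [mem_Iio, ← Subtype.coe_lt_coe, homeomorphUnitSphereProd_apply_snd_coe, mem_ball_zero_iff]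
    by_cases hy : (y : E) ∈ ball (0 : E) 1
    · rw [indicator_of_mem hy, indicator_of_mem (hiff.2 hy), Pi.one_apply, mul_one]
    · rw [indicator_of_notMem hy, indicator_of_notMem (mt hiff.1 hy), mul_zero]
  simp_rw [hl]
  rw [← lintegral_indicator measurableSet_ball,
    lintegral_subtype_comap (measurableSet_singleton (0 : E)).compl
      ((ball (0 : E) 1).indicator (fun y => h (‖y‖⁻¹ • y))),
    restrict_compl_singleton]

/-- The point of `ℝᵏ⁺²` with first coordinate `p.1` and remaining coordinates `p.2`. -/
noncomputable def euclideanCons (k : ℕ) (p : ℝ × EuclideanSpace ℝ (Fin (k + 1))) :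
    EuclideanSpace ℝ (Fin (k + 2)) :=
  WithLp.toLp 2 (Fin.cons p.1 (WithLp.ofLp p.2))

theorem measurePreserving_euclideanCons (k : ℕ) : MeasurePreserving (euclideanCons k) := by
  have h1 : MeasurePreserving (fun p : ℝ × (Fin (k + 1) → ℝ) =>
      (Fin.cons p.1 p.2 : Fin (k + 2) → ℝ)) := by
    convert (volume_preserving_piFinSuccAbove (fun _ : Fin (k + 2) => ℝ) 0).symm using 1
    ext p : 1
    simp [MeasurableEquiv.piFinSuccAbove, Fin.insertNthEquiv]
  have h2 : MeasurePreserving (Prod.map id WithLp.ofLp :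
      ℝ × EuclideanSpace ℝ (Fin (k + 1)) → ℝ × (Fin (k + 1) → ℝ)) :=
    (MeasurePreserving.id (volume : Measure ℝ)).prod (PiLp.volume_preserving_ofLp (Fin (k + 1)))
  exact (PiLp.volume_preserving_toLp (Fin (k + 2))).comp (h1.comp h2)

theorem norm_euclideanCons (k : ℕ) (a : ℝ) (z : EuclideanSpace ℝ (Fin (k + 1))) :
    ‖euclideanCons k (a, z)‖ = √(a ^ 2 + ‖z‖ ^ 2) := by
  rw [EuclideanSpace.norm_eq, EuclideanSpace.norm_sq_eq, Fin.sum_univ_succ]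
  simp [euclideanCons]

theorem exists_orthonormalBasis_pair {k : ℕ} {e t : EuclideanSpace ℝ (Fin (k + 2))}
    (he : ‖e‖ = 1) (ht : ‖t‖ = 1) (het : inner ℝ e t = 0) :
    ∃ b : OrthonormalBasis (Fin (k + 2)) ℝ (EuclideanSpace ℝ (Fin (k + 2))), b 0 = e ∧ b 1 = t := by
  have hv : Orthonormal ℝ (({0, 1} : Set (Fin (k + 2))).domRestrict
      (fun i => if i = 0 then e else t)) := by
    constructor
    · rintro ⟨i, rfl | rfl⟩ <;> simp [he, ht]
    · rintro ⟨i, rfl | rfl⟩ ⟨j, rfl | rfl⟩ hij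
      · exact absurd rfl hij
      · simpa using het
      · simpa [real_inner_comm] using het
      · exact absurd rfl hij
  obtain ⟨b, hb⟩ := hv.exists_orthonormalBasis_extension_of_card_eq (by simp)
  exact ⟨b, by simpa using hb 0 (by simp), by simpa using hb 1 (by simp)⟩

theorem lintegral_ball_inner_pair {k : ℕ} {e t : EuclideanSpace ℝ (Fin (k + 2))}
    (he : ‖e‖ = 1) (ht : ‖t‖ = 1) (het : inner ℝ e t = 0) {Φ : ℝ × ℝ → ℝ≥0∞} (hΦ : Measurable Φ) :
    ∫⁻ y : EuclideanSpace ℝ (Fin (k + 2)) in ball 0 1,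
        Φ (inner ℝ (‖y‖⁻¹ • y) e, inner ℝ (‖y‖⁻¹ • y) t) =
      ∫⁻ y : EuclideanSpace ℝ (Fin (k + 2)) in ball 0 1, Φ (‖y‖⁻¹ * y 0, ‖y‖⁻¹ * y 1) := by
  obtain ⟨b, rfl, rfl⟩ := exists_orthonormalBasis_pair he ht het
  have hm : Measurable fun y : EuclideanSpace ℝ (Fin (k + 2)) =>
      (ball 0 1).indicator (fun y => Φ (‖y‖⁻¹ * y 0, ‖y‖⁻¹ * y 1)) y := by
    refine Measurable.indicator (hΦ.comp ?_) measurableSet_ball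
    fun_prop
  rw [← lintegral_indicator measurableSet_ball, ← lintegral_indicator measurableSet_ball,
    ← b.repr.measurePreserving.lintegral_comp hm]
  refine lintegral_congr fun y => ?_
  by_cases hy : y ∈ ball 0 1
  · rw [indicator_of_mem hy, indicator_of_mem (by simpa using hy)]
    simp only [LinearIsometryEquiv.norm_map, b.repr_apply_apply, inner_smul_left]
    simp [real_inner_comm]
  · rw [indicator_of_notMem hy, indicator_of_notMem (by simpa using hy)]

/-- The unnormalized density of the gnomonic coordinate on the sphere of `ℝⁿ`. -/
noncomputable def gnomonicDensity (n : ℕ) (τ : ℝ) : ℝ≥0∞ :=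
  ENNReal.ofReal ((√(1 + τ ^ 2) ^ n)⁻¹)

theorem measurable_gnomonicDensity (n : ℕ) : Measurable (gnomonicDensity n) := by
  unfold gnomonicDensity; fun_prop

/-- Split `y = (a, z)` and substitute `a = ‖z‖ τ`, with Jacobian `‖z‖`. The ball becomes `√(1 + τ²)
‖z‖ < 1`, and rescaling `z` by `√(1 + τ²)` makes the domain independent of `τ`. The volume
contributes `k + 1` powers of `1 / √(1 + τ²)` and the Jacobian one more, whence the density with
index `k + 2`. -/
theorem lintegral_ball_slice (k : ℕ) {Φ : ℝ × ℝ → ℝ≥0∞} (hΦ : Measurable Φ) :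
    ∫⁻ y : EuclideanSpace ℝ (Fin (k + 2)) in ball 0 1, Φ (‖y‖⁻¹ * y 0, ‖y‖⁻¹ * y 1) =
      ∫⁻ τ : ℝ, gnomonicDensity (k + 2) τ * ∫⁻ z : EuclideanSpace ℝ (Fin (k + 1)) in ball 0 1,
        ENNReal.ofReal ‖z‖ * Φ (τ / √(1 + τ ^ 2), (‖z‖⁻¹ * z 0) / √(1 + τ ^ 2)) := by
  have hm : Measurable fun y : EuclideanSpace ℝ (Fin (k + 2)) =>
      (ball 0 1).indicator (fun y => Φ (‖y‖⁻¹ * y 0, ‖y‖⁻¹ * y 1)) y := by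
    refine Measurable.indicator (hΦ.comp ?_) measurableSet_ball
    fun_prop
  set Ψ : ℝ × EuclideanSpace ℝ (Fin (k + 1)) → ℝ≥0∞ := fun p =>
    {p : ℝ × EuclideanSpace ℝ (Fin (k + 1)) | √(p.1 ^ 2 + ‖p.2‖ ^ 2) < 1}.indicator
      (fun p => Φ (p.1 / √(p.1 ^ 2 + ‖p.2‖ ^ 2), p.2 0 / √(p.1 ^ 2 + ‖p.2‖ ^ 2))) p with hΨ
  have hΨm : Measurable Ψ := by
    refine Measurable.indicator (hΦ.comp (by fun_prop)) ?_
    exact measurableSet_lt (by fun_prop) measurable_const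
  have h1 : ∫⁻ y : EuclideanSpace ℝ (Fin (k + 2)) in ball 0 1, Φ (‖y‖⁻¹ * y 0, ‖y‖⁻¹ * y 1) =
      ∫⁻ z : EuclideanSpace ℝ (Fin (k + 1)), ∫⁻ a : ℝ, Ψ (a, z) := by
    rw [← lintegral_indicator measurableSet_ball,
      ← (measurePreserving_euclideanCons k).lintegral_comp hm, ← lintegral_prod_symm' _ hΨm]
    refine lintegral_congr fun p => ?_
    obtain ⟨a, z⟩ := p
    simp only [hΨ, indicator, mem_ball, dist_zero_right, norm_euclideanCons, mem_ofPred_eq]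
    congr 1
    simp only [div_eq_inv_mul]
    rfl
  have h2 : ∀ᵐ z : EuclideanSpace ℝ (Fin (k + 1)),
      ∫⁻ a : ℝ, Ψ (a, z) = ∫⁻ τ : ℝ, ENNReal.ofReal ‖z‖ * Ψ (‖z‖ * τ, z) := by
    filter_upwards [Measure.ae_ne volume (0 : EuclideanSpace ℝ (Fin (k + 1)))] with z hz
    have hz' : 0 < ‖z‖ := norm_pos_iff.2 hz
    rw [lintegral_const_mul' _ _ ENNReal.ofReal_ne_top]
    have := lintegral_comp_smul_addHaar (volume : Measure ℝ) hz'.ne' (f := fun a => Ψ (a, z))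
      (hΨm.comp (by fun_prop))
    simp only [smul_eq_mul, Module.finrank_self, pow_one] at this
    rw [this, abs_of_pos (inv_pos.2 hz'), ← mul_assoc, ← ENNReal.ofReal_mul hz'.le,
      mul_inv_cancel₀ hz'.ne', ENNReal.ofReal_one, one_mul]
  rw [h1, lintegral_congr_ae h2, lintegral_lintegral_swap]
  swap
  · refine Measurable.aemeasurable ?_
    refine Measurable.mul (by fun_prop) (hΨm.comp ?_)
    fun_prop
  refine lintegral_congr fun τ => ?_
  have hs : 0 < √(1 + τ ^ 2) := by positivity
  have hsc := lintegral_comp_smul_addHaar (volume : Measure (EuclideanSpace ℝ (Fin (k + 1))))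
    hs.ne' (f := fun z => (ball 0 1).indicator (fun z : EuclideanSpace ℝ (Fin (k + 1)) =>
        ENNReal.ofReal ‖z‖ * Φ (τ / √(1 + τ ^ 2), (‖z‖⁻¹ * z 0) / √(1 + τ ^ 2))) z) (by
      refine Measurable.indicator (Measurable.mul (by fun_prop) (hΦ.comp ?_)) measurableSet_ball
      fun_prop)
  -- The extra factor `√(1 + τ²)` turns the weight `‖z‖` into the norm of the rescaled point; it is
  -- cancelled from both sides at the end.
  have hpt : ∀ z : EuclideanSpace ℝ (Fin (k + 1)), z ≠ 0 →
      ENNReal.ofReal (√(1 + τ ^ 2)) * (ENNReal.ofReal ‖z‖ * Ψ (‖z‖ * τ, z)) =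
      (ball 0 1).indicator (fun z : EuclideanSpace ℝ (Fin (k + 1)) =>
        ENNReal.ofReal ‖z‖ * Φ (τ / √(1 + τ ^ 2), (‖z‖⁻¹ * z 0) / √(1 + τ ^ 2)))
        (√(1 + τ ^ 2) • z) := by
    intro z hz
    have hz' : 0 < ‖z‖ := norm_pos_iff.2 hz
    have hn : √((‖z‖ * τ) ^ 2 + ‖z‖ ^ 2) = √(1 + τ ^ 2) * ‖z‖ := by
      rw [show (‖z‖ * τ) ^ 2 + ‖z‖ ^ 2 = (1 + τ ^ 2) * ‖z‖ ^ 2 by ring,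
        Real.sqrt_mul (by positivity), Real.sqrt_sq hz'.le]
    have hn2 : ‖√(1 + τ ^ 2) • z‖ = √(1 + τ ^ 2) * ‖z‖ := by
      rw [norm_smul, Real.norm_of_nonneg hs.le]
    simp only [hΨ, indicator, mem_ball, dist_zero_right, mem_ofPred_eq, hn, hn2]
    split_ifs with h
    · rw [ENNReal.ofReal_mul hs.le, mul_assoc]
      have e1 : ‖z‖ * τ / (√(1 + τ ^ 2) * ‖z‖) = τ / √(1 + τ ^ 2) := by field_simp
      have e2 : z 0 / (√(1 + τ ^ 2) * ‖z‖) =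
          (√(1 + τ ^ 2) * ‖z‖)⁻¹ * (√(1 + τ ^ 2) • z) 0 / √(1 + τ ^ 2) := by
        rw [PiLp.smul_apply, smul_eq_mul]
        field_simp
      rw [e1, e2]
    · simp
  have hae : ∫⁻ z : EuclideanSpace ℝ (Fin (k + 1)),
      ENNReal.ofReal (√(1 + τ ^ 2)) * (ENNReal.ofReal ‖z‖ * Ψ (‖z‖ * τ, z)) = _ := 
    lintegral_congr_ae (by
      filter_upwards [Measure.ae_ne volume (0 : EuclideanSpace ℝ (Fin (k + 1)))] with z hz
      exact hpt z hz)
  rw [lintegral_const_mul' _ _ ENNReal.ofReal_ne_top, hsc, lintegral_indicator measurableSet_ball]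
    at hae
  rw [← ENNReal.mul_right_inj (a := ENNReal.ofReal (√(1 + τ ^ 2))) (by simpa using Real.sqrt_pos.1 hs)
    ENNReal.ofReal_ne_top, hae, ← mul_assoc]
  congr 1
  rw [gnomonicDensity, ← ENNReal.ofReal_mul hs.le, abs_of_pos (by positivity)]
  congr 1
  rw [finrank_euclideanSpace_fin, pow_succ (n := k + 1)]
  field_simp

/-! ### Gamma and Beta integrals -/

theorem lintegral_ofReal_of_integral_eq {α : Type*} [MeasurableSpace α] {μ : Measure α} {f : α → ℝ}
    {c : ℝ} (hf : 0 ≤ᵐ[μ] f) (hc : 0 < c) (h : ∫ x, f x ∂μ = c) :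
    ∫⁻ x, ENNReal.ofReal (f x) ∂μ = ENNReal.ofReal c := by
  rw [← h, ofReal_integral_eq_lintegral_ofReal (.of_integral_ne_zero (h ▸ hc.ne')) hf]

theorem lintegral_abs_rpow_mul_exp_neg_mul_sq {a x : ℝ} (ha : -1 < a) (hx : 0 < x) :
    ∫⁻ τ : ℝ, ENNReal.ofReal (|τ| ^ a * Real.exp (-x * τ ^ 2)) =
      ENNReal.ofReal (x ^ (-(a + 1) / 2) * Real.Gamma ((a + 1) / 2)) := by
  refine lintegral_ofReal_of_integral_eq (.of_forall fun τ => by positivity) ?_ ?_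
  · have := Real.Gamma_pos_of_pos (s := (a + 1) / 2) (by linarith)
    positivity
  · have h := integral_comp_abs (f := fun τ : ℝ => τ ^ a * Real.exp (-x * τ ^ 2))
    simp only [sq_abs] at h
    rw [h]
    have h2 := integral_rpow_mul_exp_neg_mul_rpow (p := 2) (q := a) two_pos ha hx
    simp only [Real.rpow_two] at h2
    rw [h2]
    ring

/-- A Beta integral in gnomonic coordinates. -/
theorem lintegral_abs_rpow_mul_one_add_sq_rpow {a b : ℝ} (ha : -1 < a) (hb : (a + 1) / 2 < b) :
    ∫⁻ τ : ℝ, ENNReal.ofReal (|τ| ^ a * (1 + τ ^ 2) ^ (-b)) =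
      ENNReal.ofReal (Real.Gamma ((a + 1) / 2) * Real.Gamma (b - (a + 1) / 2) / Real.Gamma b) := by
  have hb0 : 0 < b := by linarith
  have hΓb := Real.Gamma_pos_of_pos hb0
  have hΓa := Real.Gamma_pos_of_pos (s := (a + 1) / 2) (by linarith)
  have hΓc := Real.Gamma_pos_of_pos (s := b - (a + 1) / 2) (by linarith)
  have hG : ∀ (c r : ℝ), 0 < c → 0 < r →
      ∫⁻ x in Ioi (0 : ℝ), ENNReal.ofReal (x ^ (c - 1) * Real.exp (-(r * x))) =
        ENNReal.ofReal ((1 / r) ^ c * Real.Gamma c) := fun c r hc hr => by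
    refine lintegral_ofReal_of_integral_eq ?_ ?_ (Real.integral_rpow_mul_exp_neg_mul_Ioi hc hr)
    · filter_upwards [ae_restrict_mem measurableSet_Ioi] with x hx
      have : (0 : ℝ) < x := hx
      positivity
    · have := Real.Gamma_pos_of_pos hc
      positivity
  -- Write `Γ(b) (1 + τ²)^(-b)` as a Gamma integral in `x`; after Tonelli the `τ`-integral is a
  -- Gaussian moment and the `x`-integral again a Gamma integral.
  have h1 : ∀ τ : ℝ, ENNReal.ofReal (Real.Gamma b) * ENNReal.ofReal (|τ| ^ a * (1 + τ ^ 2) ^ (-b)) =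
      ∫⁻ x in Ioi (0 : ℝ), ENNReal.ofReal (|τ| ^ a) *
        ENNReal.ofReal (x ^ (b - 1) * Real.exp (-((1 + τ ^ 2) * x))) := by
    intro τ
    rw [lintegral_const_mul' _ _ ENNReal.ofReal_ne_top, hG b _ hb0 (by positivity),
      ← ENNReal.ofReal_mul hΓb.le, ← ENNReal.ofReal_mul (by positivity),
      Real.rpow_neg (by positivity), one_div, Real.inv_rpow (by positivity)]
    congr 1
    ring
  rw [← ENNReal.mul_right_inj (a := ENNReal.ofReal (Real.Gamma b)) (by simpa using hΓb)
    ENNReal.ofReal_ne_top, ← lintegral_const_mul' _ _ ENNReal.ofReal_ne_top, lintegral_congr h1,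
    lintegral_lintegral_swap (by fun_prop)]
  have h2 : ∀ x ∈ Ioi (0 : ℝ), ∫⁻ τ : ℝ, ENNReal.ofReal (|τ| ^ a) *
        ENNReal.ofReal (x ^ (b - 1) * Real.exp (-((1 + τ ^ 2) * x))) =
      ENNReal.ofReal (Real.Gamma ((a + 1) / 2)) *
        ENNReal.ofReal (x ^ ((b - (a + 1) / 2) - 1) * Real.exp (-(1 * x))) := by
    intro x hx
    have hx : 0 < x := hx
    have : ∀ τ : ℝ, ENNReal.ofReal (|τ| ^ a) *
        ENNReal.ofReal (x ^ (b - 1) * Real.exp (-((1 + τ ^ 2) * x))) =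
        ENNReal.ofReal (x ^ (b - 1) * Real.exp (-x)) *
          ENNReal.ofReal (|τ| ^ a * Real.exp (-x * τ ^ 2)) := fun τ => by
      rw [← ENNReal.ofReal_mul (by positivity), ← ENNReal.ofReal_mul (by positivity),
        show -((1 + τ ^ 2) * x) = -x + -x * τ ^ 2 by ring, Real.exp_add]
      congr 1; ring
    rw [lintegral_congr this, lintegral_const_mul' _ _ ENNReal.ofReal_ne_top,
      lintegral_abs_rpow_mul_exp_neg_mul_sq ha hx, ← ENNReal.ofReal_mul (by positivity),
      ← ENNReal.ofReal_mul hΓa.le,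
      show b - (a + 1) / 2 - 1 = (b - 1) + (-(a + 1) / 2) by ring, Real.rpow_add hx]
    congr 1
    ring_nf
  rw [setLIntegral_congr_fun measurableSet_Ioi h2, lintegral_const_mul' _ _ ENNReal.ofReal_ne_top,
    hG _ 1 (by linarith) one_pos, ← ENNReal.ofReal_mul hΓa.le, ← ENNReal.ofReal_mul hΓb.le]
  congr 1
  rw [div_one, Real.one_rpow]
  field_simp

/-! ### The gnomonic law and the joint law of two orthogonal coordinates -/

theorem sqrt_pow_inv_eq_rpow (n : ℕ) (τ : ℝ) :
    (√(1 + τ ^ 2) ^ n)⁻¹ = (1 + τ ^ 2) ^ (-((n : ℝ) / 2)) := by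
  rw [Real.rpow_neg (by positivity), Real.sqrt_eq_rpow, ← Real.rpow_natCast, ← Real.rpow_mul
    (by positivity)]
  ring_nf

theorem lintegral_gnomonicDensity {n : ℕ} (hn : 2 ≤ n) :
    ∫⁻ τ, gnomonicDensity n τ =
      ENNReal.ofReal (√Real.pi * Real.Gamma (((n : ℝ) - 1) / 2) / Real.Gamma ((n : ℝ) / 2)) := by
  have hn' : (2 : ℝ) ≤ n := by exact_mod_cast hn
  have := lintegral_abs_rpow_mul_one_add_sq_rpow (a := 0) (b := (n : ℝ) / 2) (by norm_num)
    (by linarith)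
  simp only [Real.rpow_zero, one_mul, zero_add, Real.Gamma_one_half_eq] at this
  simp only [gnomonicDensity, sqrt_pow_inv_eq_rpow, this]
  ring_nf

theorem gnomonicDensity_const_pos {n : ℕ} (hn : 2 ≤ n) :
    0 < √Real.pi * Real.Gamma (((n : ℝ) - 1) / 2) / Real.Gamma ((n : ℝ) / 2) := by
  have hn' : (2 : ℝ) ≤ n := by exact_mod_cast hn
  have h1 := Real.Gamma_pos_of_pos (s := ((n : ℝ) - 1) / 2) (by linarith)
  have h2 := Real.Gamma_pos_of_pos (s := (n : ℝ) / 2) (by linarith)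
  have := Real.pi_pos
  positivity

/-- The law of the gnomonic coordinate of a uniformly distributed point on the sphere of `ℝⁿ`. -/
noncomputable def gnomonicMeasure (n : ℕ) : Measure ℝ :=
  (∫⁻ τ, gnomonicDensity n τ)⁻¹ • volume.withDensity (gnomonicDensity n)

theorem lintegral_gnomonicMeasure (n : ℕ) {f : ℝ → ℝ≥0∞} (hf : Measurable f) :
    ∫⁻ τ, f τ ∂gnomonicMeasure n =
      (∫⁻ τ, gnomonicDensity n τ)⁻¹ * ∫⁻ τ, gnomonicDensity n τ * f τ := by
  rw [gnomonicMeasure, lintegral_smul_measure, smul_eq_mul,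
    lintegral_withDensity_eq_lintegral_mul _ (measurable_gnomonicDensity n) hf]
  rfl

theorem isProbabilityMeasure_gnomonicMeasure {n : ℕ} (hn : 2 ≤ n) :
    IsProbabilityMeasure (gnomonicMeasure n) := by
  constructor
  have h := lintegral_gnomonicMeasure n (f := 1) measurable_one
  simp only [Pi.one_apply, mul_one, lintegral_const, one_mul] at h
  rw [h, lintegral_gnomonicDensity hn]
  exact ENNReal.inv_mul_cancel (by simpa using gnomonicDensity_const_pos hn) ENNReal.ofReal_ne_top

theorem lintegral_sphere_slice (k : ℕ) {e t : EuclideanSpace ℝ (Fin (k + 2))}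
    (he : ‖e‖ = 1) (ht : ‖t‖ = 1) (het : inner ℝ e t = 0) {Φ : ℝ × ℝ → ℝ≥0∞} (hΦ : Measurable Φ) :
    Measure.volumeIoiPow (k + 1) (Iio ⟨1, mem_Ioi.2 one_pos⟩) *
      ∫⁻ η : sphere (0 : EuclideanSpace ℝ (Fin (k + 2))) 1,
        Φ (inner ℝ (η : EuclideanSpace ℝ (Fin (k + 2))) e,
          inner ℝ (η : EuclideanSpace ℝ (Fin (k + 2))) t) ∂volume.toSphere =
      ∫⁻ τ : ℝ, gnomonicDensity (k + 2) τ * ∫⁻ z : EuclideanSpace ℝ (Fin (k + 1)) in ball 0 1,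
        ENNReal.ofReal ‖z‖ * Φ (τ / √(1 + τ ^ 2), (‖z‖⁻¹ * z 0) / √(1 + τ ^ 2)) := by
  rw [← lintegral_ball_slice k hΦ, ← lintegral_ball_inner_pair he ht het hΦ,
    lintegral_ball_normalize volume
      (h := fun y : EuclideanSpace ℝ (Fin (k + 2)) => Φ (inner ℝ y e, inner ℝ y t))
      (hΦ.comp (by fun_prop))]
  simp

/-- The joint law of two orthogonal coordinates of a uniformly distributed point on the sphere. -/
theorem exists_map_normalizedSphereMeasure_eq (k : ℕ) :
    ∃ ν : Measure ℝ, IsProbabilityMeasure ν ∧ ν.map (fun v => -v) = ν ∧ (∀ᵐ v ∂ν, |v| ≤ 1) ∧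
      ∀ e t : EuclideanSpace ℝ (Fin (k + 2)), ‖e‖ = 1 → ‖t‖ = 1 → inner ℝ e t = 0 →
        (normalizedSphereMeasure (k + 2)).map
          (fun η : sphere (0 : EuclideanSpace ℝ (Fin (k + 2))) 1 =>
          (inner ℝ (η : EuclideanSpace ℝ (Fin (k + 2))) e,
            inner ℝ (η : EuclideanSpace ℝ (Fin (k + 2))) t)) =
        ((gnomonicMeasure (k + 2)).prod ν).map
          (fun p => (p.1 / √(1 + p.1 ^ 2), p.2 / √(1 + p.1 ^ 2))) := by
  -- The weight `‖z‖` is the Jacobian from the slicing. After normalization, `ν` is the law under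
  -- `μ` of the first coordinate of `z / ‖z‖`, so it does not depend on `e` and `t`.
  set μ : Measure (EuclideanSpace ℝ (Fin (k + 1))) :=
    (volume.restrict (ball 0 1)).withDensity (fun z => ENNReal.ofReal ‖z‖) with hμ
  have hdm : Measurable fun z : EuclideanSpace ℝ (Fin (k + 1)) => ENNReal.ofReal ‖z‖ := by fun_prop
  have hμi : ∀ {f : EuclideanSpace ℝ (Fin (k + 1)) → ℝ≥0∞}, Measurable f →
      ∫⁻ z, f z ∂μ = ∫⁻ z in ball 0 1, ENNReal.ofReal ‖z‖ * f z := fun hf => by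
    rw [hμ, lintegral_withDensity_eq_lintegral_mul _ hdm hf]; rfl
  have hN1 : μ univ ≠ ∞ := by
    have : μ univ ≤ volume (ball (0 : EuclideanSpace ℝ (Fin (k + 1))) 1) := by
      rw [hμ, withDensity_apply _ MeasurableSet.univ, Measure.restrict_univ, ← setLIntegral_one]
      refine setLIntegral_mono measurable_const fun z hz => ?_
      rw [mem_ball_zero_iff] at hz
      exact ENNReal.ofReal_le_one.2 hz.le
    exact (this.trans_lt measure_ball_lt_top).ne
  have hN0 : μ univ ≠ 0 := by
    rw [hμ, withDensity_apply _ MeasurableSet.univ, Measure.restrict_univ]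
    intro h
    rw [lintegral_eq_zero_iff hdm] at h
    have h2 : ∀ᵐ z : EuclideanSpace ℝ (Fin (k + 1)) ∂(volume.restrict (ball 0 1)), False := by
      filter_upwards [h, ae_restrict_of_ae (Measure.ae_ne volume (0 : EuclideanSpace ℝ (Fin (k + 1))))]
        with z hz hz0
      simp at hz
      exact hz0 hz
    rw [Filter.eventually_false_iff_eq_bot, ae_eq_bot, Measure.restrict_eq_zero] at h2
    exact (measure_ball_pos volume _ one_pos).ne' h2
  set g : EuclideanSpace ℝ (Fin (k + 1)) → ℝ := fun z => ‖z‖⁻¹ * z 0 with hg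
  have hgm : Measurable g := by fun_prop
  refine ⟨(μ univ)⁻¹ • μ.map g, ⟨?_⟩, ?_, ?_, ?_⟩
  · rw [Measure.smul_apply, Measure.map_apply hgm MeasurableSet.univ, preimage_univ, smul_eq_mul,
      ENNReal.inv_mul_cancel hN0 hN1]
  · rw [Measure.map_smul]
    congr 1
    refine Measure.ext_of_lintegral _ fun f hf => ?_
    rw [lintegral_map hf measurable_neg, lintegral_map (f := fun v => f (-v)) (hf.comp measurable_neg) hgm,
      lintegral_map hf hgm, hμi (f := fun z => f (-g z)) (hf.comp hgm.neg),
      hμi (f := fun z => f (g z)) (hf.comp hgm),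
      ← lintegral_indicator measurableSet_ball, ← lintegral_indicator measurableSet_ball,
      ← lintegral_neg_eq_self]
    refine lintegral_congr fun z => ?_
    simp only [indicator, mem_ball_zero_iff, norm_neg, hg]
    simp
  · refine Measure.ae_smul_measure ?_ _
    rw [ae_map_iff hgm.aemeasurable (measurableSet_le (by fun_prop) measurable_const)]
    refine .of_forall fun z => ?_
    have : |z 0| ≤ ‖z‖ := PiLp.norm_apply_le z 0
    rw [hg, abs_mul, abs_inv, abs_norm]
    rcases (norm_nonneg z).eq_or_lt with h | h
    · simp [← h]
    · rw [inv_mul_le_iff₀ h]; simpa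
  · intro e t he ht het
    have := isProbabilityMeasure_gnomonicMeasure (n := k + 2) (by omega)
    have hm1 : Measurable fun η : sphere (0 : EuclideanSpace ℝ (Fin (k + 2))) 1 =>
          (inner ℝ (η : EuclideanSpace ℝ (Fin (k + 2))) e,
            inner ℝ (η : EuclideanSpace ℝ (Fin (k + 2))) t) := by fun_prop
    have hm2 : Measurable fun p : ℝ × ℝ => (p.1 / √(1 + p.1 ^ 2), p.2 / √(1 + p.1 ^ 2)) := by
      fun_prop
    set κ := Measure.volumeIoiPow (k + 1) (Iio ⟨1, mem_Ioi.2 one_pos⟩) with hκ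
    have hκ0 : κ ≠ 0 := by
      rw [hκ, Measure.volumeIoiPow_apply_Iio]; simp; positivity
    have hκ1 : κ ≠ ∞ := by
      rw [hκ, Measure.volumeIoiPow_apply_Iio]; exact ENNReal.ofReal_ne_top
    set Z := ∫⁻ τ, gnomonicDensity (k + 2) τ with hZ
    have hZ0 : Z ≠ 0 := by
      rw [hZ, lintegral_gnomonicDensity (by omega)]
      simpa using gnomonicDensity_const_pos (n := k + 2) (by omega)
    have hZ1 : Z ≠ ∞ := by
      rw [hZ, lintegral_gnomonicDensity (by omega)]; exact ENNReal.ofReal_ne_top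
    set T := (volume : Measure (EuclideanSpace ℝ (Fin (k + 2)))).toSphere univ with hT
    have hslice : ∀ {Φ : ℝ × ℝ → ℝ≥0∞}, Measurable Φ →
        κ * ∫⁻ η : sphere (0 : EuclideanSpace ℝ (Fin (k + 2))) 1,
          Φ (inner ℝ (η : EuclideanSpace ℝ (Fin (k + 2))) e,
            inner ℝ (η : EuclideanSpace ℝ (Fin (k + 2))) t) ∂volume.toSphere =
        ∫⁻ τ : ℝ, gnomonicDensity (k + 2) τ *
          ∫⁻ z, Φ (τ / √(1 + τ ^ 2), g z / √(1 + τ ^ 2)) ∂μ := fun {Φ} hΦ => by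
      rw [hκ, lintegral_sphere_slice k he ht het hΦ]
      refine lintegral_congr fun τ => ?_
      rw [hμi (f := fun z => Φ (τ / √(1 + τ ^ 2), g z / √(1 + τ ^ 2))) (hΦ.comp (by fun_prop))]
    -- The slicing identity at `Φ = 1` matches the normalizing constants of the two sides.
    have hone : κ * T = Z * μ univ := by
      have h := hslice (Φ := fun _ => 1) measurable_const
      simp only [lintegral_const, one_mul] at h
      rw [lintegral_mul_const _ (measurable_gnomonicDensity _)] at h
      exact h
    refine Measure.ext_of_lintegral _ fun Φ hΦ => ?_
    have hT0 : T ≠ 0 := by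
      rintro h
      rw [h, mul_zero] at hone
      exact mul_ne_zero hZ0 hN0 hone.symm
    have hΨ : Measurable fun p : ℝ × ℝ => Φ (p.1 / √(1 + p.1 ^ 2), p.2 / √(1 + p.1 ^ 2)) :=
      hΦ.comp hm2
    rw [lintegral_map hΦ hm1, lintegral_map hΦ hm2, lintegral_prod _ hΨ.aemeasurable,
      lintegral_gnomonicMeasure _ hΨ.lintegral_prod_right', normalizedSphereMeasure,
      lintegral_smul_measure, smul_eq_mul]
    have h3 : ∀ τ : ℝ, ∫⁻ v, Φ (τ / √(1 + τ ^ 2), v / √(1 + τ ^ 2)) ∂((μ univ)⁻¹ • μ.map g) =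
        (μ univ)⁻¹ * ∫⁻ z, Φ (τ / √(1 + τ ^ 2), g z / √(1 + τ ^ 2)) ∂μ := fun τ => by
      rw [lintegral_smul_measure, smul_eq_mul,
        lintegral_map (f := fun v => Φ (τ / √(1 + τ ^ 2), v / √(1 + τ ^ 2)))
          (hΦ.comp (by fun_prop)) hgm]
    simp only [h3, mul_left_comm _ (μ univ)⁻¹]
    rw [lintegral_const_mul' _ _ (ENNReal.inv_ne_top.2 hN0), ← hslice hΦ, ← mul_assoc, ← mul_assoc,
      ← ENNReal.mul_inv (Or.inl hZ0) (Or.inl hZ1), ← hone,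
      ENNReal.mul_inv (Or.inl hκ0) (Or.inl hκ1), mul_right_comm κ⁻¹ T⁻¹ κ,
      ENNReal.inv_mul_cancel hκ0 hκ1, one_mul]

/-! ### Convexity, Chebyshev's inequality and the comparison of directions -/

/-- On `[-|y|, |y|]` a convex function is at most its larger endpoint value, and by evenness both
endpoint values are `φ y`. -/
theorem ConvexOn.le_of_even_of_abs_le {S : Set ℝ} {φ : ℝ → ℝ} (hφ : ConvexOn ℝ S φ)
    (heven : ∀ x, φ (-x) = φ x) {x y : ℝ} (hy : y ∈ S) (hy' : -y ∈ S) (hxy : |x| ≤ |y|) :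
    φ x ≤ φ y := by
  have key : ∀ z : ℝ, z ∈ S → -z ∈ S → |x| ≤ z → φ x ≤ φ z := fun z hz hz' h => by
    have := hφ.le_max_of_mem_Icc hz' hz (abs_le.1 h)
    rwa [heven, max_self] at this
  rcases abs_cases y with ⟨h, -⟩ | ⟨h, -⟩
  · exact key y hy hy' (h ▸ hxy)
  · rw [← heven y]
    exact key (-y) hy' (by simpa using hy) (h ▸ hxy)

theorem convexOn_abs_affine_rpow (α β : ℝ) {q : ℝ} (hq : 1 ≤ q) :
    ConvexOn ℝ univ fun x : ℝ => |α * x + β| ^ q := by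
  refine ⟨convex_univ, fun x _ y _ a b ha hb hab => ?_⟩
  have h1 : |α * (a • x + b • y) + β| ≤ a * |α * x + β| + b * |α * y + β| := by
    have : α * (a • x + b • y) + β = a * (α * x + β) + b * (α * y + β) := by
      simp only [smul_eq_mul]; linear_combination (-β) * hab
    rw [this]
    refine (abs_add_le _ _).trans (le_of_eq ?_)
    rw [abs_mul, abs_mul, abs_of_nonneg ha, abs_of_nonneg hb]
  exact (Real.rpow_le_rpow (abs_nonneg _) h1 (by linarith)).trans
    ((convexOn_rpow hq).2 (abs_nonneg (α * x + β)) (abs_nonneg (α * y + β)) ha hb hab)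

theorem concaveOn_affine_rpow {α β s : ℝ} (hs0 : 0 ≤ s) (hs1 : s ≤ 1) {S : Set ℝ}
    (hS : Convex ℝ S) (hpos : ∀ x ∈ S, 0 ≤ α * x + β) :
    ConcaveOn ℝ S fun x : ℝ => (α * x + β) ^ s := by
  refine ⟨hS, fun x hx y hy a b ha hb hab => ?_⟩
  have : α * (a • x + b • y) + β = a • (α * x + β) + b • (α * y + β) := by
    simp only [smul_eq_mul]; linear_combination (-β) * hab
  simp only [this]
  exact (Real.concaveOn_rpow hs0 hs1).2 (hpos x hx) (hpos y hy) ha hb hab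

theorem abs_div_sqrt_one_add_sq_le_one (τ : ℝ) : |τ / √(1 + τ ^ 2)| ≤ 1 := by
  rw [abs_div, abs_of_nonneg (Real.sqrt_nonneg _), div_le_one (by positivity)]
  exact Real.abs_le_sqrt (by linarith)

theorem abs_div_sqrt_one_add_sq_mono {x y : ℝ} (h : |x| ≤ |y|) :
    |x / √(1 + x ^ 2)| ≤ |y / √(1 + y ^ 2)| := by
  rw [← sq_le_sq, div_pow, div_pow, Real.sq_sqrt (by positivity), Real.sq_sqrt (by positivity),
    div_le_div_iff₀ (by positivity) (by positivity)]
  have := sq_le_sq.2 h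
  nlinarith

/-- A version of Chebyshev's inequality for oppositely ordered functions of `|τ|`. -/
theorem integral_mul_nonpos_of_oppositely_ordered {μ : Measure ℝ} {F R w : ℝ → ℝ} {m : ℝ}
    (hF0 : ∀ τ, 0 ≤ F τ) (hF : ∀ x y, |x| ≤ |y| → F y ≤ F x) (hR : ∀ x y, |x| ≤ |y| → R x ≤ R y)
    (hw : ∀ τ, 0 ≤ w τ) (hi : Integrable (fun τ => w τ * (R τ - m)) μ)
    (hFi : Integrable (fun τ => F τ * (w τ * (R τ - m))) μ)
    (h0 : ∫ τ, w τ * (R τ - m) ∂μ = 0) : ∫ τ, F τ * (w τ * (R τ - m)) ∂μ ≤ 0 := by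
  -- `c` separates the values of `F`: where `R > m` it bounds `F` above, and where `R ≤ m` it bounds
  -- `F` below, since such points have smaller `|τ|`. If `R > m` never occurs, `c = 0`, which `F ≥
  -- 0` accommodates.
  set c := sSup (F '' {τ | m < R τ}) with hc
  have hbdd : BddAbove (F '' {τ | m < R τ}) :=
    ⟨F 0, by rintro _ ⟨τ, -, rfl⟩; exact hF 0 τ (by simp)⟩
  have hle : ∀ τ, F τ * (w τ * (R τ - m)) ≤ c * (w τ * (R τ - m)) := fun τ => by
    rcases lt_or_ge m (R τ) with h | h
    · exact mul_le_mul_of_nonneg_right (le_csSup hbdd ⟨τ, h, rfl⟩)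
        (mul_nonneg (hw τ) (by linarith))
    · refine mul_le_mul_of_nonpos_right (Real.sSup_le ?_ (hF0 τ))
        (mul_nonpos_of_nonneg_of_nonpos (hw τ) (by linarith))
      rintro _ ⟨σ, hσ, rfl⟩
      refine hF _ _ (le_of_not_ge fun hστ => ?_)
      have := hR _ _ hστ
      have hσ : m < R σ := hσ
      linarith
  calc _ ≤ ∫ τ, c * (w τ * (R τ - m)) ∂μ := integral_mono hFi (hi.const_mul c) hle
    _ = 0 := by rw [integral_const_mul, h0, mul_zero]

/-- The weighted mean of `|aτ + bv|^q` in gnomonic coordinates. -/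
noncomputable def sliceMean (μ ν : Measure ℝ) (q : ℝ) (f : ℝ → ℝ) (a b : ℝ) : ℝ :=
  ∫ p : ℝ × ℝ, f (p.1 / √(1 + p.1 ^ 2)) *
    |a * (p.1 / √(1 + p.1 ^ 2)) + b * (p.2 / √(1 + p.1 ^ 2))| ^ q ∂(μ.prod ν)

section
variable {μ ν : Measure ℝ} [IsProbabilityMeasure μ] [IsProbabilityMeasure ν] {q : ℝ}

theorem integrable_abs_affine_rpow (hν : ∀ᵐ v ∂ν, |v| ≤ 1) (hq : 0 ≤ q) (a b : ℝ) :
    Integrable (fun v => |a + b * v| ^ q) ν := by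
  refine Integrable.of_bound (by fun_prop) ((|a| + |b|) ^ q) ?_
  filter_upwards [hν] with v hv
  rw [Real.norm_of_nonneg (by positivity)]
  refine Real.rpow_le_rpow (abs_nonneg _) ((abs_add_le _ _).trans ?_) hq
  rw [abs_mul]
  nlinarith [abs_nonneg b]

theorem integrable_sliceMean (hν : ∀ᵐ v ∂ν, |v| ≤ 1) (hq : 0 ≤ q) {f : ℝ → ℝ}
    (hf : Measurable f) {B : ℝ} (hB : ∀ u, |u| ≤ 1 → |f u| ≤ B) (a b : ℝ) :
    Integrable (fun p : ℝ × ℝ => f (p.1 / √(1 + p.1 ^ 2)) *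
      |a * (p.1 / √(1 + p.1 ^ 2)) + b * (p.2 / √(1 + p.1 ^ 2))| ^ q) (μ.prod ν) := by
  have hB0 : 0 ≤ B := (abs_nonneg _).trans (hB 0 (by simp))
  refine Integrable.of_bound (Measurable.aestronglyMeasurable ?_) (B * (|a| + |b|) ^ q) ?_
  · exact (hf.comp (by fun_prop)).mul (by fun_prop)
  have hν' : ∀ᵐ p ∂(μ.prod ν), |p.2| ≤ 1 := Measure.quasiMeasurePreserving_snd.ae hν
  filter_upwards [hν'] with p hp
  rw [norm_mul, Real.norm_of_nonneg (by positivity : 0 ≤ |a * (p.1 / √(1 + p.1 ^ 2)) +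
    b * (p.2 / √(1 + p.1 ^ 2))| ^ q)]
  refine mul_le_mul (hB _ (abs_div_sqrt_one_add_sq_le_one _)) ?_ (by positivity) hB0
  refine Real.rpow_le_rpow (abs_nonneg _) ((abs_add_le _ _).trans ?_) hq
  rw [abs_mul, abs_mul]
  have h1 := abs_div_sqrt_one_add_sq_le_one p.1
  have h2 : |p.2 / √(1 + p.1 ^ 2)| ≤ 1 := by
    rw [abs_div, abs_of_nonneg (Real.sqrt_nonneg _), div_le_one (by positivity)]
    exact hp.trans (Real.one_le_sqrt.2 (by nlinarith))
  nlinarith [abs_nonneg a, abs_nonneg b]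

theorem sliceMean_integrand_eq (q a b τ v : ℝ) :
    |a * (τ / √(1 + τ ^ 2)) + b * (v / √(1 + τ ^ 2))| ^ q =
      (√(1 + τ ^ 2) ^ q)⁻¹ * |a * τ + b * v| ^ q := by
  have hs : 0 < √(1 + τ ^ 2) := by positivity
  rw [show a * (τ / √(1 + τ ^ 2)) + b * (v / √(1 + τ ^ 2)) = (a * τ + b * v) / √(1 + τ ^ 2) by ring,
    abs_div, abs_of_pos hs, Real.div_rpow (abs_nonneg _) hs.le, div_eq_inv_mul]

theorem sliceMean_eq (hν : ∀ᵐ v ∂ν, |v| ≤ 1) (hq : 0 ≤ q) {f : ℝ → ℝ}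
    (hf : Measurable f) {B : ℝ} (hB : ∀ u, |u| ≤ 1 → |f u| ≤ B) (a b : ℝ) :
    Integrable (fun τ => f (τ / √(1 + τ ^ 2)) *
      ((√(1 + τ ^ 2) ^ q)⁻¹ * ∫ v, |a * τ + b * v| ^ q ∂ν)) μ ∧
    sliceMean μ ν q f a b = ∫ τ, f (τ / √(1 + τ ^ 2)) *
      ((√(1 + τ ^ 2) ^ q)⁻¹ * ∫ v, |a * τ + b * v| ^ q ∂ν) ∂μ := by
  have hint := integrable_sliceMean (μ := μ) hν hq hf hB a b
  have h : ∀ τ : ℝ, ∫ v, f (τ / √(1 + τ ^ 2)) *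
      |a * (τ / √(1 + τ ^ 2)) + b * (v / √(1 + τ ^ 2))| ^ q ∂ν = f (τ / √(1 + τ ^ 2)) *
      ((√(1 + τ ^ 2) ^ q)⁻¹ * ∫ v, |a * τ + b * v| ^ q ∂ν) := fun τ => by
    simp only [sliceMean_integrand_eq, integral_const_mul]
  refine ⟨by simpa only [h] using hint.integral_prod_left, ?_⟩
  rw [sliceMean, integral_prod _ hint]
  simp only [h]

/-- Chebyshev's inequality for the even part of `f`, decreasing in `|τ|` by concavity, against `R`,
increasing in `|τ|` by convexity. The hypothesis `hone` says that `R - m` has weighted mean zero. -/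
theorem sliceMean_le (hμneg : μ.map (fun τ => -τ) = μ) (hνneg : ν.map (fun v => -v) = ν)
    (hν : ∀ᵐ v ∂ν, |v| ≤ 1) (hq : 1 ≤ q) {f : ℝ → ℝ} (hf : Measurable f)
    (hf0 : ∀ u, |u| ≤ 1 → 0 ≤ f u) {B : ℝ} (hB : ∀ u, |u| ≤ 1 → |f u| ≤ B)
    (hfc : ConcaveOn ℝ (Icc (-1) 1) f) {a b : ℝ}
    (hone : sliceMean μ ν q (fun _ => 1) a b = sliceMean μ ν q (fun _ => 1) 0 1) :
    sliceMean μ ν q f a b ≤ sliceMean μ ν q f 0 1 := by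
  have hq0 : 0 ≤ q := by linarith
  set w : ℝ → ℝ := fun τ => (√(1 + τ ^ 2) ^ q)⁻¹ with hw
  set R : ℝ → ℝ := fun τ => ∫ v, |a * τ + b * v| ^ q ∂ν with hR
  set m : ℝ := ∫ v, |v| ^ q ∂ν with hm
  -- The disjunctive bound covers the three uses: `f`, its reflection, and the constant `1`.
  have hsub : ∀ {g : ℝ → ℝ}, Measurable g → (∀ u, |u| ≤ 1 → |g u| ≤ B ∨ |g u| ≤ 1) →
      Integrable (fun τ => g (τ / √(1 + τ ^ 2)) * (w τ * (R τ - m))) μ ∧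
      ∫ τ, g (τ / √(1 + τ ^ 2)) * (w τ * (R τ - m)) ∂μ =
        sliceMean μ ν q g a b - sliceMean μ ν q g 0 1 := fun {g} hg hgB => by
    have hgB' : ∀ u, |u| ≤ 1 → |g u| ≤ max B 1 := fun u hu => le_max_iff.2 (hgB u hu)
    obtain ⟨i1, e1⟩ := sliceMean_eq (μ := μ) hν hq0 hg hgB' a b
    obtain ⟨i2, e2⟩ := sliceMean_eq (μ := μ) hν hq0 hg hgB' 0 1
    simp only [zero_mul, zero_add, one_mul] at i2 e2
    have hfun : (fun τ => g (τ / √(1 + τ ^ 2)) * (w τ * (R τ - m))) = fun τ =>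
        g (τ / √(1 + τ ^ 2)) * ((√(1 + τ ^ 2) ^ q)⁻¹ * ∫ v, |a * τ + b * v| ^ q ∂ν) -
        g (τ / √(1 + τ ^ 2)) * ((√(1 + τ ^ 2) ^ q)⁻¹ * ∫ v, |v| ^ q ∂ν) := by
      funext τ; simp only [hw, hR, hm]; ring
    rw [hfun, e1, e2, integral_sub i1 i2]
    exact ⟨i1.sub i2, rfl⟩
  have hνflip : ∀ τ, ∫ v, |a * τ + b * v| ^ q ∂ν = ∫ v, |a * τ - b * v| ^ q ∂ν := fun τ => by
    conv_lhs => rw [← hνneg]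
    rw [integral_map measurable_neg.aemeasurable (by fun_prop)]
    simp only [mul_neg, sub_eq_add_neg]
  have hReven : ∀ τ, R (-τ) = R τ := fun τ => by
    simp only [hR]
    rw [hνflip τ]
    refine integral_congr_ae (.of_forall fun v => ?_)
    simp only
    rw [← abs_neg]; ring_nf
  have hRmono : ∀ x y, |x| ≤ |y| → R x ≤ R y := fun x y hxy => by
    -- Symmetrizing in `v` makes the integrand itself even and convex in `τ`, so monotonicity holds
    -- pointwise in `v`.
    have hdouble : ∀ τ, 2 * R τ = ∫ v, (|a * τ + b * v| ^ q + |a * τ + -(b * v)| ^ q) ∂ν := fun τ => by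
      rw [integral_add (integrable_abs_affine_rpow hν hq0 _ _)
        (by simpa using integrable_abs_affine_rpow hν hq0 (a * τ) (-b))]
      simp only [← sub_eq_add_neg]
      rw [← hνflip]; ring
    have hii : ∀ τ, Integrable (fun v => |a * τ + b * v| ^ q + |a * τ + -(b * v)| ^ q) ν := fun τ =>
      (integrable_abs_affine_rpow hν hq0 _ _).add
        (by simpa using integrable_abs_affine_rpow hν hq0 (a * τ) (-b))
    have : 2 * R x ≤ 2 * R y := by
      rw [hdouble, hdouble]
      refine integral_mono (hii x) (hii y) fun v => ?_
      refine ((convexOn_abs_affine_rpow a (b * v) hq).add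
        (convexOn_abs_affine_rpow a (-(b * v)) hq)).le_of_even_of_abs_le (fun z => ?_)
        (mem_univ _) (mem_univ _) hxy
      simp only [Pi.add_apply]
      rw [add_comm, ← abs_neg, ← abs_neg (a * -z + b * v)]
      ring_nf
    linarith
  have hneg : ∀ τ : ℝ, -τ / √(1 + (-τ) ^ 2) = -(τ / √(1 + τ ^ 2)) := fun τ => by
    rw [neg_sq, neg_div]
  obtain ⟨i1, e1⟩ := hsub hf (fun u hu => Or.inl (hB u hu))
  obtain ⟨i2, e2⟩ := hsub (g := fun u => f (-u)) (hf.comp measurable_neg)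
    (fun u hu => Or.inl (hB (-u) (by simpa using hu)))
  obtain ⟨i3, e3⟩ := hsub (g := fun _ => 1) measurable_const (fun u hu => Or.inr (by simp))
  simp only [one_mul] at i3 e3
  rw [hone, sub_self] at e3
  have hflip : ∫ τ, f (-(τ / √(1 + τ ^ 2))) * (w τ * (R τ - m)) ∂μ =
      ∫ τ, f (τ / √(1 + τ ^ 2)) * (w τ * (R τ - m)) ∂μ := by
    conv_rhs => rw [← hμneg]
    rw [integral_map measurable_neg.aemeasurable (by rw [hμneg]; exact i1.aestronglyMeasurable)]
    refine integral_congr_ae (.of_forall fun τ => ?_)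
    simp only [hneg, hReven]
    simp only [hw, neg_sq]
  -- Since `μ`, `w` and `R` are invariant under `τ ↦ -τ`, replacing `f` by `F` just doubles the
  -- integral.
  set F : ℝ → ℝ := fun τ => f (τ / √(1 + τ ^ 2)) + f (-(τ / √(1 + τ ^ 2))) with hF
  have hmem : ∀ τ : ℝ, τ / √(1 + τ ^ 2) ∈ Icc (-1 : ℝ) 1 := fun τ =>
    abs_le.1 (abs_div_sqrt_one_add_sq_le_one τ)
  have hmem' : ∀ τ : ℝ, -(τ / √(1 + τ ^ 2)) ∈ Icc (-1 : ℝ) 1 := fun τ =>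
    abs_le.1 (by rw [abs_neg]; exact abs_div_sqrt_one_add_sq_le_one τ)
  have hfc' : ConvexOn ℝ (Icc (-1) 1) fun u => -(f u + f (-u)) := by
    refine ConcaveOn.neg ⟨convex_Icc _ _, fun x hx y hy α β hα hβ hαβ => ?_⟩
    have h1 := hfc.2 hx hy hα hβ hαβ
    have h2 := hfc.2 (x := -x) (y := -y) ⟨by linarith [hx.2], by linarith [hx.1]⟩
      ⟨by linarith [hy.2], by linarith [hy.1]⟩ hα hβ hαβ
    rw [show α • -x + β • -y = -(α • x + β • y) by simp only [smul_eq_mul]; ring] at h2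
    simp only [smul_eq_mul] at h1 h2 ⊢
    linarith
  have hFi : (fun τ => F τ * (w τ * (R τ - m))) = fun τ =>
      f (τ / √(1 + τ ^ 2)) * (w τ * (R τ - m)) + f (-(τ / √(1 + τ ^ 2))) * (w τ * (R τ - m)) := by
    funext τ; simp only [hF]; ring
  have hcheb := integral_mul_nonpos_of_oppositely_ordered (μ := μ) (F := F) (R := R) (w := w)
    (m := m)
    (fun τ => add_nonneg (hf0 _ (abs_div_sqrt_one_add_sq_le_one τ))
      (hf0 _ (by rw [abs_neg]; exact abs_div_sqrt_one_add_sq_le_one τ)))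
    (fun x y hxy => by
      have := hfc'.le_of_even_of_abs_le (fun z => by rw [neg_neg, add_comm]) (hmem y) (hmem' y)
        (abs_div_sqrt_one_add_sq_mono hxy)
      simp only [hF]; linarith)
    hRmono (fun τ => by positivity) i3 (by rw [hFi]; exact i1.add i2) e3
  rw [hFi, integral_add i1 i2, hflip, e1] at hcheb
  linarith

end

/-! ### Binomial series and a quadratic transformation of `₂F₁` -/

theorem Ring.choose_eq_descPochhammer_eval_div (a : ℝ) (k : ℕ) :
    Ring.choose a k = (descPochhammer ℝ k).eval a / k.factorial := by
  rw [Ring.choose_eq_smul, Polynomial.descPochhammer_smeval_eq_ascPochhammer,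
    Polynomial.ascPochhammer_smeval_cast, Polynomial.ascPochhammer_smeval_eq_eval,
    descPochhammer_eval_eq_ascPochhammer, smul_eq_mul, div_eq_inv_mul]

theorem Ring.choose_succ_eq_mul_div (a : ℝ) (k : ℕ) :
    Ring.choose a (k + 1) = Ring.choose a k * (a - k) / (k + 1) := by
  rw [choose_eq_descPochhammer_eval_div, choose_eq_descPochhammer_eval_div,
    descPochhammer_succ_eval, Nat.factorial_succ]
  push_cast
  field_simp

theorem abs_ring_choose_sub_le {s : ℝ} (hs0 : 0 ≤ s) (hs1 : s ≤ 1) (m j : ℕ) :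
    |Ring.choose (s - 2 * m) j| ≤ (2 * m + j).choose j := by
  induction j with
  | zero => simp
  | succ j ih =>
    rw [Ring.choose_succ_eq_mul_div, abs_div, abs_mul, abs_of_pos (by positivity : (0 : ℝ) < j + 1),
      div_le_iff₀ (by positivity)]
    have h1 : |s - 2 * m - j| ≤ 2 * m + j + 1 := by
      rw [abs_le]; constructor <;> linarith [(Nat.cast_nonneg m : (0 : ℝ) ≤ m),
        (Nat.cast_nonneg j : (0 : ℝ) ≤ j)]
    have h2 : ((2 * m + j + 1 : ℕ) : ℝ) * (2 * m + j).choose j =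
        (2 * m + (j + 1)).choose (j + 1) * ((j + 1 : ℕ) : ℝ) := by
      exact_mod_cast Nat.add_one_mul_choose_eq (2 * m + j) j
    push_cast at h2 ⊢
    rw [← h2, mul_comm]
    exact mul_le_mul h1 ih (abs_nonneg _) (by positivity)

theorem abs_ring_choose_le_one {s : ℝ} (hs0 : 0 ≤ s) (hs1 : s ≤ 1) (j : ℕ) :
    |Ring.choose s j| ≤ 1 := by
  simpa using abs_ring_choose_sub_le hs0 hs1 0 j

theorem mem_eball_zero_one {x : ℝ} (hx : |x| < 1) : x ∈ Metric.eball (0 : ℝ) 1 := by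
  rw [Metric.mem_eball, edist_zero_right, ← ofReal_norm, ENNReal.ofReal_lt_one]
  exact hx

theorem hasSum_one_add_rpow {x : ℝ} (a : ℝ) (hx : |x| < 1) :
    HasSum (fun k => Ring.choose a k * x ^ k) ((1 + x) ^ a) := by
  have h := (Real.one_add_rpow_hasFPowerSeriesOnBall_zero (a := a)).hasSum (y := x)
    (mem_eball_zero_one hx)
  simpa [mul_comm, binomialSeries, FormalMultilinearSeries.coeff_ofScalars] using h

theorem descPochhammer_eval_add (a : ℝ) (m n : ℕ) :
    (descPochhammer ℝ (m + n)).eval a =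
      (descPochhammer ℝ m).eval a * (descPochhammer ℝ n).eval (a - m) := by
  rw [← descPochhammer_mul]; simp

theorem ascPochhammer_eval_add (a : ℝ) (m n : ℕ) :
    (ascPochhammer ℝ (m + n)).eval a =
      (ascPochhammer ℝ m).eval a * (ascPochhammer ℝ n).eval (a + m) := by
  rw [← ascPochhammer_mul]; simp

/-- Coefficients of the even binomial expansion integrated against `(1 + τ²)^(-β)`. -/
noncomputable def evenBinomialCoeff (s β : ℝ) (m : ℕ) : ℝ :=
  Ring.choose s (2 * m) * ((2 * m).factorial / (4 ^ m * m.factorial * (ascPochhammer ℝ m).eval β))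

/-- Chu–Vandermonde: regrouping the falling and rising factorials shows that, up to a factor
depending only on `k`, the term at `(m, j)` is `choose (s - k) m * choose (β - 1 + k) j`. -/
theorem sum_antidiagonal_evenBinomialCoeff {s β : ℝ} (hβ : 0 < β) (k : ℕ) :
    ∑ p ∈ Finset.HasAntidiagonal.antidiagonal k,
        evenBinomialCoeff s β p.1 * 4 ^ p.1 * Ring.choose (s - 2 * p.1) p.2 =
      (k.factorial : ℝ)⁻¹ * (ascPochhammer ℝ k).eval (-s) * (ascPochhammer ℝ k).eval (1 - β - s) *
        ((ascPochhammer ℝ k).eval β)⁻¹ := by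
  have hasc : ∀ m : ℕ, (ascPochhammer ℝ m).eval β ≠ 0 := fun m => (ascPochhammer_pos m β hβ).ne'
  have hf : ∀ m : ℕ, (m.factorial : ℝ) ≠ 0 := fun m => by positivity
  have hV := Ring.add_choose_eq k (Commute.all (s - k) (β - 1 + k))
  have hr : (k.factorial : ℝ)⁻¹ * (ascPochhammer ℝ k).eval (-s) *
        (ascPochhammer ℝ k).eval (1 - β - s) * ((ascPochhammer ℝ k).eval β)⁻¹ =
      (descPochhammer ℝ k).eval s * Ring.choose (s - k + (β - 1 + k)) k /
        (ascPochhammer ℝ k).eval β := by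
    rw [ascPochhammer_eval_neg_eq_descPochhammer, show 1 - β - s = -(s - k + (β - 1 + k)) by ring,
      ascPochhammer_eval_neg_eq_descPochhammer, Ring.choose_eq_descPochhammer_eval_div]
    have : ((-1 : ℝ) ^ k) * (-1) ^ k = 1 := by rw [← mul_pow]; simp
    have h1 := hasc k
    have h2 := hf k
    field_simp
    linear_combination ((descPochhammer ℝ k).eval s *
      (descPochhammer ℝ k).eval (s - k + (β - 1 + k))) * this
  rw [hr, hV, Finset.mul_sum, Finset.sum_div]
  refine Finset.sum_congr rfl fun ⟨m, j⟩ hp => ?_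
  rw [Finset.HasAntidiagonal.mem_antidiagonal] at hp
  simp only at hp ⊢
  subst hp
  have e1 : (descPochhammer ℝ (2 * m)).eval s * (descPochhammer ℝ j).eval (s - 2 * m) =
      (descPochhammer ℝ (m + j)).eval s * (descPochhammer ℝ m).eval (s - (m + j : ℕ)) := by
    have h1 := descPochhammer_eval_add s (2 * m) j
    have h2 := descPochhammer_eval_add s (m + j) m
    rw [show m + j + m = 2 * m + j by ring, h1] at h2
    push_cast at h2 ⊢
    exact h2
  have e2 : (ascPochhammer ℝ (m + j)).eval β =
      (ascPochhammer ℝ m).eval β * (descPochhammer ℝ j).eval (β - 1 + (m + j : ℕ)) := by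
    rw [ascPochhammer_eval_add, descPochhammer_eval_eq_ascPochhammer]
    congr 2
    push_cast; ring
  have h3 := hasc (m + j)
  rw [e2] at h3 ⊢
  have h3' := (mul_ne_zero_iff.1 h3).2
  have h4 := hasc m
  rw [evenBinomialCoeff, Ring.choose_eq_descPochhammer_eval_div, Ring.choose_eq_descPochhammer_eval_div,
    Ring.choose_eq_descPochhammer_eval_div, Ring.choose_eq_descPochhammer_eval_div]
  have h5 := hf m
  have h6 := hf j
  have h7 := hf (2 * m)
  field_simp
  linear_combination e1

/-- The ratio of consecutive terms is `(m + 1/2) / (β + m) ≤ 1`. -/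
theorem centralBinom_div_ascPochhammer_le_one {β : ℝ} (hβ : 1 / 2 ≤ β) (m : ℕ) :
    ((2 * m).factorial : ℝ) / (4 ^ m * m.factorial * (ascPochhammer ℝ m).eval β) ≤ 1 := by
  have hasc : ∀ m : ℕ, 0 < (ascPochhammer ℝ m).eval β :=
    fun m => ascPochhammer_pos m β (by linarith)
  induction m with
  | zero => simp
  | succ m ih =>
    have h1 := hasc m
    rw [div_le_one (by positivity)] at ih
    rw [div_le_one (by have := hasc (m + 1); positivity), ascPochhammer_succ_eval,
      show 2 * (m + 1) = 2 * m + 1 + 1 by ring, Nat.factorial_succ, Nat.factorial_succ,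
      Nat.factorial_succ, pow_succ]
    push_cast
    calc (2 * (m : ℝ) + 1 + 1) * ((2 * m + 1) * (2 * m).factorial)
        ≤ (2 * (m : ℝ) + 1 + 1) * ((2 * m + 1) *
          (4 ^ m * m.factorial * (ascPochhammer ℝ m).eval β)) := by gcongr
      _ ≤ (2 * (m : ℝ) + 1 + 1) * ((2 * (β + m)) *
          (4 ^ m * m.factorial * (ascPochhammer ℝ m).eval β)) := by gcongr; linarith
      _ = _ := by ring

theorem abs_evenBinomialCoeff_le_one {s β : ℝ} (hs0 : 0 ≤ s) (hs1 : s ≤ 1) (hβ : 1 / 2 ≤ β)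
    (m : ℕ) : |evenBinomialCoeff s β m| ≤ 1 := by
  have h := ascPochhammer_pos m β (by linarith)
  rw [evenBinomialCoeff, abs_mul, abs_of_nonneg (by positivity : (0 : ℝ) ≤
    (2 * m).factorial / (4 ^ m * m.factorial * (ascPochhammer ℝ m).eval β))]
  exact mul_le_one₀ (abs_ring_choose_le_one hs0 hs1 _) (by positivity)
    (centralBinom_div_ascPochhammer_le_one hβ m)

/-- The power series with coefficients `evenBinomialCoeff s β`. -/
noncomputable def evenBinomialSum (s β : ℝ) : ℝ → ℝ :=
  (FormalMultilinearSeries.ofScalars ℝ (evenBinomialCoeff s β)).sum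

theorem one_le_radius_evenBinomial {s β : ℝ} (hs0 : 0 ≤ s) (hs1 : s ≤ 1) (hβ : 1 / 2 ≤ β) :
    1 ≤ (FormalMultilinearSeries.ofScalars ℝ (evenBinomialCoeff s β)).radius := by
  have := (FormalMultilinearSeries.ofScalars ℝ (evenBinomialCoeff s β)).le_radius_of_bound 1
    (r := 1) (fun n => by
      rw [FormalMultilinearSeries.ofScalars_norm]
      simpa using abs_evenBinomialCoeff_le_one hs0 hs1 hβ n)
  simpa using this

theorem hasSum_evenBinomialSum {s β : ℝ} (hs0 : 0 ≤ s) (hs1 : s ≤ 1) (hβ : 1 / 2 ≤ β) {Y : ℝ}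
    (hY : |Y| < 1) :
    HasSum (fun m => evenBinomialCoeff s β m * Y ^ m) (evenBinomialSum s β Y) := by
  have hr := one_le_radius_evenBinomial hs0 hs1 hβ
  have h := ((FormalMultilinearSeries.ofScalars ℝ
    (evenBinomialCoeff s β)).hasFPowerSeriesOnBall (one_pos.trans_le hr)).hasSum (y := Y)
    (Metric.eball_subset_eball hr (mem_eball_zero_one hY))
  simpa [evenBinomialSum, mul_comm] using h

/-- The radius is one unless some parameter is a nonpositive integer; then the coefficients
eventually vanish (for `c`, because `0⁻¹ = 0`) and the radius is infinite. -/
theorem ordinaryHypergeometricSeries_one_le_radius (a b c : ℝ) :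
    1 ≤ (ordinaryHypergeometricSeries ℝ a b c).radius := by
  by_cases h : ∀ k : ℕ, (k : ℝ) ≠ -a ∧ (k : ℝ) ≠ -b ∧ (k : ℝ) ≠ -c
  · rw [ordinaryHypergeometricSeries_radius_eq_one ℝ a b c h]
  · push Not at h
    obtain ⟨k, hk⟩ := h
    by_cases h1 : (k : ℝ) = -a
    · rw [show a = -(k : ℝ) by linarith, ordinaryHypergeometric_radius_top_of_neg_nat₁]; simp
    by_cases h2 : (k : ℝ) = -b
    · rw [show b = -(k : ℝ) by linarith, ordinaryHypergeometric_radius_top_of_neg_nat₂]; simp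
    · rw [show c = -(k : ℝ) by linarith [hk h1 h2], ordinaryHypergeometric_radius_top_of_neg_nat₃]
      simp

/-- A quadratic transformation, near the origin. -/
theorem one_add_rpow_mul_evenBinomialSum_of_small {s β : ℝ} (hs0 : 0 ≤ s) (hs1 : s ≤ 1)
    (hβ : 1 / 2 ≤ β) {ρ : ℝ} (hρ : |ρ| < 1 / 16) :
    (1 + ρ) ^ s * evenBinomialSum s β (4 * ρ / (1 + ρ) ^ 2) =
      ordinaryHypergeometric (-s) (1 - β - s) β ρ := by
  have hρ' := abs_lt.1 hρ
  set f : ℕ × ℕ → ℝ := fun p =>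
    (evenBinomialCoeff s β p.1 * 4 ^ p.1 * Ring.choose (s - 2 * p.1) p.2) * ρ ^ (p.1 + p.2) with hf
  have hsum : Summable f := by
    -- The coefficients are at most `4 ^ m * 2 ^ (2 * m + j)`; this is where the threshold `1 / 16`
    -- comes from.
    have hg : Summable fun p : ℕ × ℕ => (16 * |ρ|) ^ p.1 * (2 * |ρ|) ^ p.2 :=
      Summable.mul_of_nonneg (summable_geometric_of_lt_one (by positivity) (by linarith))
        (summable_geometric_of_lt_one (by positivity) (by linarith))
        (fun _ => by positivity) (fun _ => by positivity)
    refine Summable.of_norm_bounded hg fun ⟨m, j⟩ => ?_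
    have h1 := abs_evenBinomialCoeff_le_one hs0 hs1 hβ m
    have h2 : |Ring.choose (s - 2 * m) j| ≤ 2 ^ (2 * m + j) :=
      (abs_ring_choose_sub_le hs0 hs1 m j).trans (by exact_mod_cast Nat.choose_le_two_pow _ _)
    simp only [hf, Real.norm_eq_abs, abs_mul, abs_pow]
    calc |evenBinomialCoeff s β m| * |4| ^ m * |Ring.choose (s - 2 * m) j| * |ρ| ^ (m + j)
        ≤ 1 * |4| ^ m * 2 ^ (2 * m + j) * |ρ| ^ (m + j) := by gcongr
      _ = (16 * |ρ|) ^ m * (2 * |ρ|) ^ j := by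
        rw [abs_of_pos (by norm_num : (0 : ℝ) < 4), mul_pow, mul_pow, pow_add, pow_add, pow_mul,
          show (16 : ℝ) = 4 * 4 by norm_num, mul_pow]
        norm_num
        ring
  -- The double series is summed in two ways: over `j` first it gives the left side through the
  -- expansion of `(1 + ρ)^(s - 2m)`; along antidiagonals it gives the hypergeometric series.
  have h1 : HasSum (fun m => evenBinomialCoeff s β m * 4 ^ m * ρ ^ m * (1 + ρ) ^ (s - 2 * m))
      (∑' p, f p) := by
    refine hsum.hasSum.prod_fiberwise fun m => ?_
    have := (hasSum_one_add_rpow (s - 2 * m) (hρ.trans (by norm_num))).mul_left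
      (evenBinomialCoeff s β m * 4 ^ m * ρ ^ m)
    refine this.congr_fun ?_ 
    intro j
    simp only [hf, pow_add]; ring
  have h2 : HasSum (fun m => evenBinomialCoeff s β m * 4 ^ m * ρ ^ m * (1 + ρ) ^ (s - 2 * m))
      ((1 + ρ) ^ s * evenBinomialSum s β (4 * ρ / (1 + ρ) ^ 2)) := by
    have hY : |4 * ρ / (1 + ρ) ^ 2| < 1 := by
      rw [abs_div, abs_of_pos (by nlinarith : 0 < (1 + ρ) ^ 2), div_lt_one (by nlinarith), abs_mul,
        abs_of_pos (by norm_num : (0 : ℝ) < 4)]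
      nlinarith
    refine ((hasSum_evenBinomialSum hs0 hs1 hβ hY).mul_left ((1 + ρ) ^ s)).congr_fun fun m => ?_
    have hp : 0 < 1 + ρ := by linarith
    rw [Real.rpow_sub hp, show (2 * (m : ℝ)) = ((2 * m : ℕ) : ℝ) by push_cast; ring,
      Real.rpow_natCast, div_pow, mul_pow, ← pow_mul]
    ring
  have h3 : HasSum (fun k => ((k.factorial : ℝ)⁻¹ * (ascPochhammer ℝ k).eval (-s) *
      (ascPochhammer ℝ k).eval (1 - β - s) * ((ascPochhammer ℝ k).eval β)⁻¹) * ρ ^ k)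
      (∑' p, f p) := by
    refine (Finset.HasAntidiagonal.sigmaAntidiagonalEquivProd.hasSum_iff.2 hsum.hasSum).sigma
      fun k => ?_
    rw [← sum_antidiagonal_evenBinomialCoeff (by linarith), Finset.sum_mul]
    have := Finset.hasSum (Finset.HasAntidiagonal.antidiagonal k) f
    have e : ∑ p ∈ Finset.HasAntidiagonal.antidiagonal k, f p = ∑ p ∈ Finset.HasAntidiagonal.antidiagonal k,
        evenBinomialCoeff s β p.1 * 4 ^ p.1 * Ring.choose (s - 2 * p.1) p.2 * ρ ^ k :=
      Finset.sum_congr rfl fun p hp => by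
        rw [Finset.HasAntidiagonal.mem_antidiagonal] at hp
        simp only [hf, hp]
    rw [← e]
    exact this
  rw [h2.unique h1, ← h3.tsum_eq, ordinaryHypergeometric_eq_tsum]
  simp only [smul_eq_mul]

/-- A quadratic transformation of the hypergeometric function. -/
theorem one_add_rpow_mul_evenBinomialSum {s β : ℝ} (hs0 : 0 ≤ s) (hs1 : s ≤ 1)
    (hβ : 1 / 2 ≤ β) {ρ : ℝ} (hρ0 : 0 ≤ ρ) (hρ1 : ρ < 1) :
    (1 + ρ) ^ s * evenBinomialSum s β (4 * ρ / (1 + ρ) ^ 2) =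
      ordinaryHypergeometric (-s) (1 - β - s) β ρ := by
  -- Analytic continuation from a neighbourhood of `0`. On this interval `4|x| < (1 + x)²`, so the
  -- argument of the series stays in the unit disc.
  have habs : ∀ x ∈ Ioo (-1 / 16 : ℝ) 1, |x| < 1 := fun x hx => by
    rw [abs_lt]; constructor <;> linarith [hx.1, hx.2]
  have hA1 : AnalyticOnNhd ℝ
      (fun ρ => (1 + ρ) ^ s * evenBinomialSum s β (4 * ρ / (1 + ρ) ^ 2)) (Ioo (-1 / 16) 1) := by
    intro x hx
    have hpos : 0 < (1 + x) ^ 2 := by nlinarith [hx.1]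
    refine AnalyticAt.mul
      (Real.one_add_rpow_hasFPowerSeriesOnBall_zero.analyticOnNhd x (mem_eball_zero_one (habs x hx))) ?_
    have hr := one_le_radius_evenBinomial hs0 hs1 hβ
    refine AnalyticAt.fun_comp (f := fun ρ : ℝ => 4 * ρ / (1 + ρ) ^ 2)
      (((FormalMultilinearSeries.ofScalars ℝ (evenBinomialCoeff s β)).hasFPowerSeriesOnBall
        (one_pos.trans_le hr)).analyticOnNhd _ (Metric.eball_subset_eball hr (mem_eball_zero_one ?_))) ?_
    · rw [abs_div, abs_of_pos hpos, div_lt_one hpos, abs_mul,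
        abs_of_pos (by norm_num : (0 : ℝ) < 4)]
      rcases abs_cases x with ⟨h, -⟩ | ⟨h, -⟩ <;> rw [h] <;> nlinarith [hx.1, hx.2]
    · exact (analyticAt_const.mul analyticAt_id).div ((analyticAt_const.add analyticAt_id).pow 2)
        hpos.ne'
  have hA2 : AnalyticOnNhd ℝ (ordinaryHypergeometric (-s) (1 - β - s) β) (Ioo (-1 / 16 : ℝ) 1) := by
    intro x hx
    have hr := ordinaryHypergeometricSeries_one_le_radius (-s) (1 - β - s) β
    exact ((ordinaryHypergeometricSeries ℝ (-s) (1 - β - s) β).hasFPowerSeriesOnBall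
        (one_pos.trans_le hr)).analyticOnNhd _ (Metric.eball_subset_eball hr (mem_eball_zero_one (habs x hx)))
  refine hA1.eqOn_of_preconnected_of_eventuallyEq hA2 isPreconnected_Ioo (z₀ := 0) (by norm_num) ?_
    (x := ρ) ⟨by linarith, hρ1⟩
  filter_upwards [Ioo_mem_nhds (show (-1 / 16 : ℝ) < 0 by norm_num)
    (show (0 : ℝ) < 1 / 16 by norm_num)] with x hx
  exact one_add_rpow_mul_evenBinomialSum_of_small hs0 hs1 hβ (abs_lt.2 ⟨by linarith [hx.1], hx.2⟩)

/-! ### Moments of the gnomonic law and the hypergeometric value -/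

theorem integral_gnomonicMeasure {n : ℕ} (hn : 2 ≤ n) (h : ℝ → ℝ) :
    ∫ τ, h τ ∂gnomonicMeasure n =
      (√Real.pi * Real.Gamma (((n : ℝ) - 1) / 2) / Real.Gamma ((n : ℝ) / 2))⁻¹ *
        ∫ τ, (1 + τ ^ 2) ^ (-((n : ℝ) / 2)) * h τ := by
  rw [gnomonicMeasure, integral_smul_measure, lintegral_gnomonicDensity hn, smul_eq_mul,
    ENNReal.toReal_inv, ENNReal.toReal_ofReal (gnomonicDensity_const_pos hn).le,
    integral_withDensity_eq_integral_toReal_smul (measurable_gnomonicDensity n)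
      (.of_forall fun τ => ENNReal.ofReal_lt_top)]
  congr 1
  refine integral_congr_ae (.of_forall fun τ => ?_)
  simp only [gnomonicDensity, sqrt_pow_inv_eq_rpow, smul_eq_mul]
  rw [ENNReal.toReal_ofReal (by positivity)]

theorem map_neg_gnomonicMeasure (n : ℕ) :
    (gnomonicMeasure n).map (fun τ => -τ) = gnomonicMeasure n := by
  refine Measure.ext_of_lintegral _ fun f hf => ?_
  rw [lintegral_map hf measurable_neg,
    lintegral_gnomonicMeasure n (f := fun τ => f (-τ)) (hf.comp measurable_neg),
    lintegral_gnomonicMeasure n hf, ← lintegral_neg_eq_self (fun τ => gnomonicDensity n τ * f τ)]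
  simp [gnomonicDensity]

theorem integral_abs_rpow_gnomonicMeasure {n : ℕ} (hn : 2 ≤ n) {a c : ℝ} (ha : -1 < a)
    (hc : (a + 1) / 2 < n / 2 + c) :
    ∫ τ, |τ| ^ a * (1 + τ ^ 2) ^ (-c) ∂gnomonicMeasure n =
      (√Real.pi * Real.Gamma (((n : ℝ) - 1) / 2) / Real.Gamma ((n : ℝ) / 2))⁻¹ *
        (Real.Gamma ((a + 1) / 2) * Real.Gamma (n / 2 + c - (a + 1) / 2) /
          Real.Gamma (n / 2 + c)) := by
  have h1 := Real.Gamma_pos_of_pos (s := (a + 1) / 2) (by linarith)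
  have h2 := Real.Gamma_pos_of_pos (s := n / 2 + c - (a + 1) / 2) (by linarith)
  have h3 := Real.Gamma_pos_of_pos (s := n / 2 + c) (by linarith)
  rw [integral_gnomonicMeasure hn]
  congr 1
  have hfun : ∀ τ : ℝ, (1 + τ ^ 2) ^ (-((n : ℝ) / 2)) * (|τ| ^ a * (1 + τ ^ 2) ^ (-c)) =
      |τ| ^ a * (1 + τ ^ 2) ^ (-((n : ℝ) / 2 + c)) := fun τ => by
    rw [show -((n : ℝ) / 2 + c) = -((n : ℝ) / 2) + -c by ring, Real.rpow_add (by positivity)]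
    ring
  simp only [hfun]
  rw [integral_eq_lintegral_of_nonneg_ae (.of_forall fun τ => by positivity)
    (Measurable.aestronglyMeasurable (by fun_prop)),
    lintegral_abs_rpow_mul_one_add_sq_rpow ha hc, ENNReal.toReal_ofReal (by positivity)]

theorem sqrt_rpow_inv_eq_rpow (q τ : ℝ) :
    (√(1 + τ ^ 2) ^ q)⁻¹ = (1 + τ ^ 2) ^ (-(q / 2)) := by
  rw [Real.rpow_neg (by positivity), Real.sqrt_eq_rpow, ← Real.rpow_mul (by positivity)]
  ring_nf

/-- Each moment is a Beta integral, and the Gamma recursion gives consecutive ratios `(m + 1/2) /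
((q + n)/2 + m)`. -/
theorem integral_even_moment {n : ℕ} (hn : 2 ≤ n) {q : ℝ} (hq : 0 ≤ q) (m : ℕ) :
    ∫ τ, (τ / √(1 + τ ^ 2)) ^ (2 * m) * (√(1 + τ ^ 2) ^ q)⁻¹ ∂gnomonicMeasure n =
      (∫ τ, (√(1 + τ ^ 2) ^ q)⁻¹ ∂gnomonicMeasure n) *
        ((2 * m).factorial / (4 ^ m * m.factorial * (ascPochhammer ℝ m).eval ((q + n) / 2))) := by
  have hn' : (2 : ℝ) ≤ n := by exact_mod_cast hn
  have hval : ∀ m : ℕ, ∫ τ, (τ / √(1 + τ ^ 2)) ^ (2 * m) * (√(1 + τ ^ 2) ^ q)⁻¹ ∂gnomonicMeasure n =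
      (√Real.pi * Real.Gamma (((n : ℝ) - 1) / 2) / Real.Gamma ((n : ℝ) / 2))⁻¹ *
        (Real.Gamma (m + 1 / 2) * Real.Gamma ((q + n - 1) / 2) / Real.Gamma ((q + n) / 2 + m)) := by
    intro m
    have h := integral_abs_rpow_gnomonicMeasure hn (a := 2 * m) (c := m + q / 2)
      (by linarith [(Nat.cast_nonneg m : (0 : ℝ) ≤ m)]) (by linarith)
    rw [show (2 * (m : ℝ) + 1) / 2 = m + 1 / 2 by ring,
      show (n : ℝ) / 2 + (m + q / 2) - (m + 1 / 2) = (q + n - 1) / 2 by ring,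
      show (n : ℝ) / 2 + (m + q / 2) = (q + n) / 2 + m by ring] at h
    rw [← h]
    refine integral_congr_ae (.of_forall fun τ => ?_)
    simp only
    rw [sqrt_rpow_inv_eq_rpow, neg_add, Real.rpow_add (by positivity),
      Real.rpow_neg (by positivity) (m : ℝ), Real.rpow_natCast, show (2 * (m : ℝ)) = ((2 * m : ℕ) : ℝ) by push_cast; ring,
      Real.rpow_natCast, div_pow, pow_mul (√_), Real.sq_sqrt (by positivity), pow_mul |τ|, sq_abs,
      pow_mul τ]
    ring
  induction m with
  | zero => simp
  | succ m ih =>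
    rw [hval] at ih ⊢
    have hβ : 0 < (q + n) / 2 + m := by positivity
    have hasc := ascPochhammer_pos m ((q + n) / 2) (by positivity)
    have hΓ := Real.Gamma_pos_of_pos hβ
    have e1 : Real.Gamma ((m + 1 : ℕ) + 1 / 2) = (m + 1 / 2) * Real.Gamma (m + 1 / 2) := by
      rw [← Real.Gamma_add_one (by positivity)]; push_cast; ring_nf
    have e2 : Real.Gamma ((q + n) / 2 + (m + 1 : ℕ)) =
        ((q + n) / 2 + m) * Real.Gamma ((q + n) / 2 + m) := by
      rw [← Real.Gamma_add_one hβ.ne']; push_cast; ring_nf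
    have e3 : (((2 * (m + 1)).factorial : ℕ) : ℝ) =
        (2 * m + 2) * ((2 * m + 1) * (2 * m).factorial) := by
      rw [show 2 * (m + 1) = 2 * m + 1 + 1 by ring, Nat.factorial_succ, Nat.factorial_succ]
      push_cast; ring
    have e4 : ((m + 1).factorial : ℝ) = (m + 1) * m.factorial := by
      rw [Nat.factorial_succ]; push_cast; ring
    rw [e1, e2, e3, e4, ascPochhammer_succ_eval]
    set I := ∫ τ, (√(1 + τ ^ 2) ^ q)⁻¹ ∂gnomonicMeasure n
    set A := (√Real.pi * Real.Gamma (((n : ℝ) - 1) / 2) / Real.Gamma ((n : ℝ) / 2))⁻¹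
    set P := (ascPochhammer ℝ m).eval ((q + n) / 2)
    have hl : A * ((m + 1 / 2) * Real.Gamma (m + 1 / 2) * Real.Gamma ((q + n - 1) / 2) /
        (((q + n) / 2 + m) * Real.Gamma ((q + n) / 2 + m))) =
        (A * (Real.Gamma (m + 1 / 2) * Real.Gamma ((q + n - 1) / 2) /
          Real.Gamma ((q + n) / 2 + m))) * ((m + 1 / 2) / ((q + n) / 2 + m)) := by
      field_simp
    rw [hl, ih, pow_succ]
    field_simp
    ring

theorem one_le_sqrt_one_add_sq (τ : ℝ) : 1 ≤ √(1 + τ ^ 2) :=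
  Real.one_le_sqrt.2 (by nlinarith)

theorem abs_pow_mul_weight_le_one {q : ℝ} (hq : 0 ≤ q) (k : ℕ) (τ : ℝ) :
    |(τ / √(1 + τ ^ 2)) ^ k * (√(1 + τ ^ 2) ^ q)⁻¹| ≤ 1 := by
  rw [abs_mul, abs_pow, abs_of_nonneg (by positivity : 0 ≤ (√(1 + τ ^ 2) ^ q)⁻¹)]
  exact mul_le_one₀ (pow_le_one₀ (abs_nonneg _) (abs_div_sqrt_one_add_sq_le_one τ)) (by positivity)
    (inv_le_one_of_one_le₀ (Real.one_le_rpow (one_le_sqrt_one_add_sq τ) hq))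

theorem integral_odd_moment (n : ℕ) (q : ℝ) {k : ℕ} (hk : Odd k) :
    ∫ τ, (τ / √(1 + τ ^ 2)) ^ k * (√(1 + τ ^ 2) ^ q)⁻¹ ∂gnomonicMeasure n = 0 := by
  have h : ∫ τ, (τ / √(1 + τ ^ 2)) ^ k * (√(1 + τ ^ 2) ^ q)⁻¹ ∂gnomonicMeasure n =
      -∫ τ, (τ / √(1 + τ ^ 2)) ^ k * (√(1 + τ ^ 2) ^ q)⁻¹ ∂gnomonicMeasure n := by
    conv_lhs => rw [← map_neg_gnomonicMeasure]
    rw [integral_map measurable_neg.aemeasurable (Measurable.aestronglyMeasurable (by fun_prop)),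
      ← integral_neg]
    refine integral_congr_ae (.of_forall fun τ => ?_)
    simp only [neg_sq, neg_div, hk.neg_pow, neg_mul]
  linarith

/-- Integrate the binomial series termwise, dominated by the geometric series in `|y|`; odd moments
vanish by symmetry. -/
theorem integral_one_sub_mul_rpow {n : ℕ} (hn : 2 ≤ n) {q s y : ℝ} (hq : 0 ≤ q) (hs0 : 0 ≤ s)
    (hs1 : s ≤ 1) (hy : |y| < 1) :
    ∫ τ, (1 - y * (τ / √(1 + τ ^ 2))) ^ s * (√(1 + τ ^ 2) ^ q)⁻¹ ∂gnomonicMeasure n =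
      (∫ τ, (√(1 + τ ^ 2) ^ q)⁻¹ ∂gnomonicMeasure n) *
        evenBinomialSum s ((q + n) / 2) (y ^ 2) := by
  have hn' : (2 : ℝ) ≤ n := by exact_mod_cast hn
  have := isProbabilityMeasure_gnomonicMeasure hn
  set F : ℕ → ℝ → ℝ := fun k τ => (Ring.choose s k * (-y) ^ k) *
    ((τ / √(1 + τ ^ 2)) ^ k * (√(1 + τ ^ 2) ^ q)⁻¹) with hF
  have hbound : ∀ k τ, ‖F k τ‖ ≤ |y| ^ k := fun k τ => by
    simp only [hF]
    rw [norm_mul, norm_mul, norm_pow, norm_neg]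
    calc ‖Ring.choose s k‖ * ‖y‖ ^ k * ‖(τ / √(1 + τ ^ 2)) ^ k * (√(1 + τ ^ 2) ^ q)⁻¹‖
        ≤ 1 * |y| ^ k * 1 := by
          gcongr
          · exact abs_ring_choose_le_one hs0 hs1 k
          · exact le_rfl
          · exact abs_pow_mul_weight_le_one hq k τ
      _ = |y| ^ k := by ring
  have hmeas : ∀ k, Measurable (F k) := fun k => by simp only [hF]; fun_prop
  have hint : ∀ k, Integrable (F k) (gnomonicMeasure n) := fun k =>
    Integrable.of_bound (hmeas k).aestronglyMeasurable _ (.of_forall (hbound k))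
  have hsummable : Summable fun k => ∫ τ, ‖F k τ‖ ∂gnomonicMeasure n := by
    refine Summable.of_nonneg_of_le (fun k => integral_nonneg fun τ => norm_nonneg _) (fun k => ?_)
      (summable_geometric_of_lt_one (abs_nonneg y) hy)
    calc ∫ τ, ‖F k τ‖ ∂gnomonicMeasure n ≤ ∫ _, |y| ^ k ∂gnomonicMeasure n :=
          integral_mono (hint k).norm (integrable_const _) (hbound k)
      _ = |y| ^ k := by simp
  have h1 := hasSum_integral_of_summable_integral_norm hint hsummable
  have hts : ∀ τ, ∑' k, F k τ =
      (1 - y * (τ / √(1 + τ ^ 2))) ^ s * (√(1 + τ ^ 2) ^ q)⁻¹ := fun τ => by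
    have hx : |-y * (τ / √(1 + τ ^ 2))| < 1 := by
      rw [abs_mul, abs_neg]
      have := abs_div_sqrt_one_add_sq_le_one τ
      nlinarith [abs_nonneg y]
    have := ((hasSum_one_add_rpow s hx).mul_right (√(1 + τ ^ 2) ^ q)⁻¹)
    rw [show 1 + -y * (τ / √(1 + τ ^ 2)) = 1 - y * (τ / √(1 + τ ^ 2)) by ring] at this
    rw [← this.tsum_eq]
    refine tsum_congr fun k => ?_
    simp only [hF, mul_pow]; ring
  simp only [hts] at h1
  have h2 := (mul_right_injective₀ (two_ne_zero' ℕ)).hasSum_iff (fun k hk => by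
    have hodd : Odd k := by
      rw [← Nat.not_even_iff_odd]
      rintro ⟨j, rfl⟩
      exact hk ⟨j, by ring⟩
    simp only [hF, integral_const_mul, integral_odd_moment n q hodd, mul_zero]) |>.2 h1
  have hY : |y ^ 2| < 1 := by rw [abs_pow]; exact pow_lt_one₀ (abs_nonneg _) hy two_ne_zero
  have h3 := (hasSum_evenBinomialSum (β := (q + n) / 2) hs0 hs1 (by linarith) hY).mul_left
    (∫ τ, (√(1 + τ ^ 2) ^ q)⁻¹ ∂gnomonicMeasure n)
  refine h2.unique (h3.congr_fun fun m => ?_)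
  simp only [Function.comp_apply, hF, integral_const_mul, integral_even_moment hn hq,
    evenBinomialCoeff]
  rw [pow_mul (-y), neg_sq]
  ring

/-- Factor out `1 + r²`, leaving `1 - y u` with `y = 2r / (1 + r²)`. Then `y² = 4ρ / (1 + ρ)²` for
`ρ = r²`, the argument of the quadratic transformation. -/
theorem integral_one_add_sq_sub_rpow {n : ℕ} (hn : 2 ≤ n) {q s r : ℝ} (hq : 0 ≤ q) (hs0 : 0 ≤ s)
    (hs1 : s ≤ 1) (hr0 : 0 ≤ r) (hr : r < 1) :
    ∫ τ, (-(2 * r) * (τ / √(1 + τ ^ 2)) + (1 + r ^ 2)) ^ s * (√(1 + τ ^ 2) ^ q)⁻¹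
        ∂gnomonicMeasure n =
      (∫ τ, (√(1 + τ ^ 2) ^ q)⁻¹ ∂gnomonicMeasure n) *
        ordinaryHypergeometric (-s) (1 - (q + n) / 2 - s) ((q + n) / 2) (r ^ 2) := by
  have hn' : (2 : ℝ) ≤ n := by exact_mod_cast hn
  have hpos : 0 < 1 + r ^ 2 := by positivity
  have hy : |2 * r / (1 + r ^ 2)| < 1 := by
    rw [abs_of_nonneg (by positivity), div_lt_one hpos]
    nlinarith [mul_pos (sub_pos.2 hr) (sub_pos.2 hr)]
  rw [← one_add_rpow_mul_evenBinomialSum hs0 hs1 (by linarith) (sq_nonneg r)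
    (pow_lt_one₀ hr0 hr two_ne_zero),
    show 4 * r ^ 2 / (1 + r ^ 2) ^ 2 = (2 * r / (1 + r ^ 2)) ^ 2 by rw [div_pow]; ring,
    mul_left_comm, ← integral_one_sub_mul_rpow hn hq hs0 hs1 hy, ← integral_const_mul]
  refine integral_congr_ae (.of_forall fun τ => ?_)
  simp only
  have h1 := abs_le.1 (abs_div_sqrt_one_add_sq_le_one τ)
  have h2 := abs_lt.1 hy
  rw [← mul_assoc, ← Real.mul_rpow hpos.le]
  · congr 2
    field_simp
    ring
  · have : 2 * r / (1 + r ^ 2) * (τ / √(1 + τ ^ 2)) ≤ 1 := by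
      have h0 : 0 ≤ 2 * r / (1 + r ^ 2) := by positivity
      nlinarith [h1.2, h2.2]
    linarith

/-! ### Reduction of `𝒦` to gnomonic coordinates and conclusion -/

theorem khavinsonK_eq_sliceMean {k : ℕ} {ν : Measure ℝ} {e t : EuclideanSpace ℝ (Fin (k + 2))}
    (he : ‖e‖ = 1)
    (hmap : (normalizedSphereMeasure (k + 2)).map
          (fun η : sphere (0 : EuclideanSpace ℝ (Fin (k + 2))) 1 =>
          (inner ℝ (η : EuclideanSpace ℝ (Fin (k + 2))) e,
            inner ℝ (η : EuclideanSpace ℝ (Fin (k + 2))) t)) =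
        ((gnomonicMeasure (k + 2)).prod ν).map
          (fun p => (p.1 / √(1 + p.1 ^ 2), p.2 / √(1 + p.1 ^ 2)))) (q r a b : ℝ) :
    khavinsonK q (r • e) (a • e + b • t) = sliceMean (gnomonicMeasure (k + 2)) ν q
      (fun u => (-(2 * r) * u + (1 + r ^ 2)) ^ ((((k + 2 : ℕ) : ℝ) - 1) * (q - 1))) a b := by
  set f : ℝ → ℝ := fun u =>
    (-(2 * r) * u + (1 + r ^ 2)) ^ ((((k + 2 : ℕ) : ℝ) - 1) * (q - 1)) with hf
  have hm1 : Measurable fun η : sphere (0 : EuclideanSpace ℝ (Fin (k + 2))) 1 =>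
          (inner ℝ (η : EuclideanSpace ℝ (Fin (k + 2))) e,
            inner ℝ (η : EuclideanSpace ℝ (Fin (k + 2))) t) := by fun_prop
  have hm2 : Measurable fun p : ℝ × ℝ => (p.1 / √(1 + p.1 ^ 2), p.2 / √(1 + p.1 ^ 2)) := by
    fun_prop
  have hg : Measurable fun w : ℝ × ℝ => f w.1 * |a * w.1 + b * w.2| ^ q := by
    simp only [hf]; fun_prop
  have h1 := integral_map (μ := normalizedSphereMeasure (k + 2)) hm1.aemeasurable
    hg.aestronglyMeasurable
  rw [hmap, integral_map hm2.aemeasurable hg.aestronglyMeasurable] at h1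
  rw [khavinsonK, sliceMean, h1]
  refine integral_congr_ae (.of_forall fun η => ?_)
  have hη : ‖(η : EuclideanSpace ℝ (Fin (k + 2)))‖ = 1 := by simp
  simp only [hf, inner_add_right, inner_smul_right]
  congr 1
  have hsq : ‖(η : EuclideanSpace ℝ (Fin (k + 2))) - r • e‖ ^ 2 =
      -(2 * r) * inner ℝ (η : EuclideanSpace ℝ (Fin (k + 2))) e + (1 + r ^ 2) := by
    rw [norm_sub_sq_real, hη, inner_smul_right, norm_smul, he, mul_one, Real.norm_eq_abs, sq_abs]
    ring
  rw [← hsq, ← Real.rpow_two, ← Real.rpow_mul (norm_nonneg _), mul_assoc]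

theorem exists_unit_orthogonal {k : ℕ} (t : EuclideanSpace ℝ (Fin (k + 2))) :
    ∃ e : EuclideanSpace ℝ (Fin (k + 2)), ‖e‖ = 1 ∧ inner ℝ e t = 0 := by
  have hfr : 0 < Module.finrank ℝ (ℝ ∙ t)ᗮ := by
    have h1 := Submodule.finrank_add_finrank_orthogonal (ℝ ∙ t)
    have h2 := finrank_span_le_card (R := ℝ) ({t} : Set (EuclideanSpace ℝ (Fin (k + 2))))
    rw [finrank_euclideanSpace_fin] at h1
    rw [Set.toFinset_singleton, Finset.card_singleton] at h2
    omega
  have := Module.finrank_pos_iff.1 hfr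
  obtain ⟨e, he⟩ := exists_norm_eq (ℝ ∙ t)ᗮ (zero_le_one (α := ℝ))
  exact ⟨e, by simpa using he,
    (Submodule.mem_orthogonal' _ _).1 e.2 t (Submodule.mem_span_singleton_self t)⟩

theorem exists_orthonormal_decomposition {k : ℕ} {e l : EuclideanSpace ℝ (Fin (k + 2))}
    (he : ‖e‖ = 1) (hl : ‖l‖ = 1) : ∃ (t : EuclideanSpace ℝ (Fin (k + 2))) (a b : ℝ),
      ‖t‖ = 1 ∧ inner ℝ e t = 0 ∧ l = a • e + b • t ∧ a ^ 2 + b ^ 2 = 1 := by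
  have key : ∃ (t : EuclideanSpace ℝ (Fin (k + 2))) (a b : ℝ),
      ‖t‖ = 1 ∧ inner ℝ e t = 0 ∧ l = a • e + b • t := by
    set a := inner ℝ e l with ha
    set w := l - a • e with hw
    have hew : inner ℝ e w = 0 := by
      rw [hw, inner_sub_right, inner_smul_right, real_inner_self_eq_norm_sq, he, ← ha]; ring
    by_cases h : w = 0
    · obtain ⟨t, ht, hte⟩ := exists_unit_orthogonal e
      exact ⟨t, a, 0, ht, by rw [real_inner_comm]; exact hte, by
        rw [zero_smul, add_zero]; exact sub_eq_zero.1 h⟩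
    · have hn : ‖w‖ ≠ 0 := norm_ne_zero_iff.2 h
      refine ⟨‖w‖⁻¹ • w, a, ‖w‖, ?_, ?_, ?_⟩
      · rw [norm_smul, norm_inv, norm_norm, inv_mul_cancel₀ hn]
      · rw [inner_smul_right, hew, mul_zero]
      · rw [smul_smul, mul_inv_cancel₀ hn, one_smul, hw]; abel
  obtain ⟨t, a, b, ht, het, rfl⟩ := key
  refine ⟨t, a, b, ht, het, rfl, ?_⟩
  have h2 : ‖a • e + b • t‖ ^ 2 = 1 := by rw [hl, one_pow]
  rw [norm_add_sq_real, inner_smul_left, inner_smul_right, het, norm_smul, norm_smul, he, ht] at h2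
  simpa using h2

/-- From `1/p ≤ 1/n` follows `1 ≤ 1/n + 1/q`, that is `nq ≤ n + q`. Working with inverses in `ℝ≥0∞`
includes `p = ∞`. The upper bound is what makes `f` concave. -/
theorem conjugate_exponent_bounds {n : ℕ} (hn : 2 ≤ n) {p : ℝ≥0∞} {q : ℝ}
    (hpq : ENNReal.HolderConjugate p (ENNReal.ofReal q)) (hp : (n : ℝ≥0∞) < p) :
    1 ≤ q ∧ ((n : ℝ) - 1) * (q - 1) ≤ 1 := by
  have hn' : (2 : ℝ) ≤ n := by exact_mod_cast hn
  have hq1 : 1 ≤ q := by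
    have h := hpq.symm.one_le
    rwa [ENNReal.one_le_ofReal] at h
  refine ⟨hq1, ?_⟩
  have hsum := hpq.inv_add_inv_eq_one
  have hP : p⁻¹ ≤ ENNReal.ofReal ((n : ℝ)⁻¹) := by
    rw [ENNReal.ofReal_inv_of_pos (by linarith), ENNReal.ofReal_natCast]
    exact ENNReal.inv_le_inv.2 hp.le
  have h1 : (1 : ℝ≥0∞) ≤ ENNReal.ofReal ((n : ℝ)⁻¹ + q⁻¹) := by
    rw [ENNReal.ofReal_add (by positivity) (by positivity),
      ENNReal.ofReal_inv_of_pos (by linarith : 0 < q), ← hsum]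
    gcongr
  rw [ENNReal.one_le_ofReal] at h1
  have hq0 : 0 < q := by linarith
  have hn0 : (0 : ℝ) < n := by linarith
  rw [← div_le_div_iff_of_pos_right (mul_pos hn0 hq0)]
  have h2 : 1 * (n * q) ≤ ((n : ℝ)⁻¹ + q⁻¹) * (n * q) := by gcongr
  rw [div_le_div_iff_of_pos_right (mul_pos hn0 hq0)]
  have h3 : ((n : ℝ)⁻¹ + q⁻¹) * (n * q) = q + n := by field_simp
  nlinarith

theorem mainTheorem7 (n : ℕ) (hn : 3 ≤ n) (p : ℝ≥0∞) (q : ℝ)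
    (hpq : ENNReal.HolderConjugate p (ENNReal.ofReal q)) (hp : (n : ℝ≥0∞) < p)
    (x : EuclideanSpace ℝ (Fin n)) (hx : ‖x‖ < 1)
    (t : EuclideanSpace ℝ (Fin n)) (ht : ‖t‖ = 1) (htx : inner ℝ t x = 0) :
    (∀ ℓ : EuclideanSpace ℝ (Fin n), ‖ℓ‖ = 1 → khavinsonK q x ℓ ≤ khavinsonK q x t) ∧
    khavinsonK q x t =
      ((n : ℝ) - 2) / (2 * Real.sqrt Real.pi) *
        (Real.Gamma (((n : ℝ) - 2) / 2) * Real.Gamma ((q + 1) / 2) /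
          Real.Gamma ((q + (n : ℝ)) / 2)) *
        ordinaryHypergeometric (((n : ℝ) - 1) * (1 - q))
          ((n : ℝ) / 2 + q * (1 / 2 - (n : ℝ))) ((q + (n : ℝ)) / 2) (‖x‖ ^ 2) := by
  obtain ⟨hq1, hs1⟩ := conjugate_exponent_bounds (by omega : 2 ≤ n) hpq hp
  obtain ⟨k, rfl⟩ : ∃ k, n = k + 2 := ⟨n - 2, by omega⟩
  have hn' : (3 : ℝ) ≤ (k + 2 : ℕ) := by exact_mod_cast hn
  set N : ℝ := ((k + 2 : ℕ) : ℝ) with hN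
  have hq0 : 0 ≤ q := by linarith
  have hs0 : 0 ≤ (N - 1) * (q - 1) := mul_nonneg (by linarith) (by linarith)
  set s := (N - 1) * (q - 1) with hs
  have hμ := isProbabilityMeasure_gnomonicMeasure (n := k + 2) (by omega)
  obtain ⟨ν, hν, hνneg, hν1, hmap⟩ := exists_map_normalizedSphereMeasure_eq k
  set μ := gnomonicMeasure (k + 2) with hμd
  have hμneg : μ.map (fun τ => -τ) = μ := map_neg_gnomonicMeasure (k + 2)
  obtain ⟨e, r, he, het, hxe, hr0⟩ : ∃ (e : EuclideanSpace ℝ (Fin (k + 2))) (r : ℝ),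
      ‖e‖ = 1 ∧ inner ℝ e t = 0 ∧ x = r • e ∧ 0 ≤ r := by
    by_cases h : x = 0
    · obtain ⟨e, he, het⟩ := exists_unit_orthogonal t
      exact ⟨e, 0, he, het, by simp [h], le_rfl⟩
    · have hn : ‖x‖ ≠ 0 := norm_ne_zero_iff.2 h
      refine ⟨‖x‖⁻¹ • x, ‖x‖, ?_, ?_, ?_, norm_nonneg x⟩
      · rw [norm_smul, norm_inv, norm_norm, inv_mul_cancel₀ hn]
      · rw [inner_smul_left, real_inner_comm, htx, mul_zero]
      · rw [smul_smul, mul_inv_cancel₀ hn, one_smul]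
  have hxr : ‖x‖ = r := by rw [hxe, norm_smul, he, mul_one, Real.norm_of_nonneg hr0]
  have hr1 : r < 1 := hxr ▸ hx
  -- the mean of `|⟨η, ℓ⟩|^q` does not depend on the unit vector `ℓ`
  have hone : ∀ (c d : EuclideanSpace ℝ (Fin (k + 2))) (a b : ℝ), ‖c‖ = 1 → ‖d‖ = 1 →
      inner ℝ c d = 0 → a ^ 2 + b ^ 2 = 1 →
      sliceMean μ ν q (fun _ => 1) a b = sliceMean μ ν q (fun _ => 1) 0 1 := by
    intro c d a b hc hd hcd hab
    -- The weight `1` is the case `r = 0`, so both sides are `𝒦` at the origin. In the rotated frame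
    -- `(-b c + a d, a c + b d)` the direction `a c + b d` has coordinates `(0, 1)`, and `ν` is the
    -- same for every frame.
    have hcongr : ∀ a b : ℝ, sliceMean μ ν q (fun _ => 1) a b = sliceMean μ ν q
        (fun u => (-(2 * 0) * u + (1 + 0 ^ 2)) ^ s) a b := fun a b => by simp
    have hunit : ∀ α β : ℝ, α ^ 2 + β ^ 2 = 1 → ‖α • c + β • d‖ = 1 := fun α β h => by
      rw [← sq_eq_sq₀ (norm_nonneg _) zero_le_one, norm_add_sq_real, inner_smul_left,
        inner_smul_right, hcd, norm_smul, norm_smul, hc, hd]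
      simpa using h
    have h2 : inner ℝ (-b • c + a • d) (a • c + b • d) = (0 : ℝ) := by
      simp only [inner_add_left, inner_add_right, inner_smul_left, inner_smul_right, hcd,
        real_inner_comm c d, real_inner_self_eq_norm_sq, hc, hd]
      simp
      ring
    have e1 := khavinsonK_eq_sliceMean hc (hmap c d hc hd hcd) q 0 a b
    have hc' := hunit (-b) a (by linarith)
    have e2 := khavinsonK_eq_sliceMean hc' (hmap _ _ hc' (hunit a b hab) h2) q 0 0 1
    rw [zero_smul, one_smul, zero_add] at e2
    rw [zero_smul] at e1
    rw [hcongr, hcongr, ← e1, ← e2]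
  set f : ℝ → ℝ := fun u => (-(2 * r) * u + (1 + r ^ 2)) ^ s with hf
  have hfm : Measurable f := by simp only [hf]; fun_prop
  have hbase : ∀ u, |u| ≤ 1 → 0 ≤ -(2 * r) * u + (1 + r ^ 2) := fun u hu => by
    nlinarith [(abs_le.1 hu).2, sq_nonneg (1 - r)]
  have hf0 : ∀ u, |u| ≤ 1 → 0 ≤ f u := fun u hu => Real.rpow_nonneg (hbase u hu) s
  have hB : ∀ u, |u| ≤ 1 → |f u| ≤ ((1 + r) ^ 2) ^ s := fun u hu => by
    rw [abs_of_nonneg (hf0 u hu)]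
    exact Real.rpow_le_rpow (hbase u hu) (by nlinarith [(abs_le.1 hu).1]) hs0
  have hfc : ConcaveOn ℝ (Icc (-1) 1) f :=
    concaveOn_affine_rpow hs0 hs1 (convex_Icc _ _) fun u hu => hbase u (abs_le.2 hu)
  have hKt : khavinsonK q x t = sliceMean μ ν q f 0 1 := by
    have := khavinsonK_eq_sliceMean he (hmap e t he ht het) q r 0 1
    rwa [zero_smul, one_smul, zero_add, ← hxe] at this
  refine ⟨fun l hl => ?_, ?_⟩
  · obtain ⟨t', a, b, ht', het', rfl, hab⟩ := exists_orthonormal_decomposition he hl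
    rw [hKt, hxe, khavinsonK_eq_sliceMean he (hmap e t' he ht' het') q r a b]
    exact sliceMean_le hμneg hνneg hν1 hq1 hfm hf0 hB hfc (hone e t' a b he ht' het' hab)
  -- Comparing the directions `e` and `t` for `f = 1` replaces `m ∫ w` by `∫ |τ|^q w`, a Beta
  -- integral, so `ν` need not be known explicitly.
  · have hmass := hone e t 1 0 he ht het (by norm_num)
    rw [(sliceMean_eq hν1 hq0 measurable_const (B := 1) (by simp) 1 0).2,
      (sliceMean_eq hν1 hq0 measurable_const (B := 1) (by simp) 0 1).2] at hmass
    simp only [one_mul, zero_mul, zero_add, add_zero, integral_const, probReal_univ, one_smul,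
      integral_mul_const] at hmass
    rw [hKt, (sliceMean_eq hν1 hq0 hfm hB 0 1).2]
    simp only [one_mul, zero_mul, zero_add, ← mul_assoc, integral_mul_const]
    have hint := integral_one_add_sq_sub_rpow (n := k + 2) (by omega) hq0 hs0 hs1 hr0 hr1
    simp only [hf]
    rw [hint, mul_right_comm, ← hmass, hxr, show (N - 1) * (1 - q) = -s by rw [hs]; ring,
      show N / 2 + q * (1 / 2 - N) = 1 - (q + N) / 2 - s by rw [hs]; ring]
    congr 1
    have hmom := integral_abs_rpow_gnomonicMeasure (n := k + 2) (by omega) (a := q) (c := q / 2)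
      (by linarith) (by linarith)
    rw [← hN, show N / 2 + q / 2 - (q + 1) / 2 = (N - 1) / 2 by ring,
      show N / 2 + q / 2 = (q + N) / 2 by ring] at hmom
    simp only [sqrt_rpow_inv_eq_rpow, mul_comm _ (|_| ^ q)]
    rw [hmom]
    -- The Beta integral produces `Γ(n/2)`; the recursion, valid since `n ≠ 2`, puts it in the
    -- stated form.
    have hΓ : Real.Gamma (N / 2) = (N - 2) / 2 * Real.Gamma ((N - 2) / 2) := by
      rw [← Real.Gamma_add_one (by linarith)]; ring_nf
    have h1 := (Real.Gamma_pos_of_pos (s := (N - 1) / 2) (by linarith)).ne'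
    have h2 := (Real.Gamma_pos_of_pos (s := (q + N) / 2) (by linarith)).ne'
    rw [hΓ]
    field_simp
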